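/- **Setting.** Let $M$ be a smooth $4$-manifold, $U\subseteq M$ open, $g$ a Lorentzian metric on $U$ of signature $(+,-,-,-)$ with a tetrad $e_A$, $g(e_A,e_B)=\eta_{AB}$, both of class $C^2$. Let $\gamma^A$ be the constant Dirac matrices (Dirac representation), $\gamma_5=i\gamma^0\gamma^1\gamma^2\gamma^3$, and $\varepsilon_{ABCD}$ the Levi-Civita tensor with $\varepsilon_{0123}=1$ (so $\varepsilon^{0123}=-1$). For a metric with a tetrad, $\nabla_A\Psi=e_A(\Psi)-\Gamma_A\Psi$ with the Fock–Ivanenko connection $\Gamma_A=-\tfrac18\gamma_{BCA}[\gamma^B,\gamma^C]$, where $\gamma_{ABC}=g(e_A,\nabla_{e_C}e_B)$ are the Levi-Civita connection coefficients. Let $\Psi:U\to\mathbb C^4$ be a $C^2$ Dirac spinor field (components in the tetrad), $m\in\mathbb R$, $\bar\Psi=\Psi^\dagger\gamma^0$, $A=\bar\Psi\Psi$, $B=i\bar\Psi\gamma_5\Psi$, $J^A=\bar\Psi\gamma^A\Psi$. Assume that $J$ is time-like, $J^2=\eta_{AB}J^AJ^B>0$ on $U$, and put $V=J/\sqrt{J^2}$.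 A dot denotes differentiation along $V$ ($\dot f=V(f)$, $\dot V_A=V^B\nabla_BV_A$); $h_A{}^C=\delta_A^C-V_AV^C$, $\omega_{BC}=\tfrac12h_B{}^Mh_C{}^N(\nabla_NV_M-\nabla_MV_N)$ and $\omega^A=-\tfrac12\varepsilon^{ABCD}\omega_{BC}V_D$. Let $\alpha,\beta:U\to\mathbb R$ be of class $C^2$ with $\alpha>0$, $\alpha+\beta>0$. The disformal metric is $$\widehat g^{\mu\nu}=\alpha g^{\mu\nu}+\beta V^\mu V^\nu,\qquad\text{i.e.}\qquad \widehat g_{\mu\nu}=\tfrac1\alpha g_{\mu\nu}-\tfrac{\beta}{\alpha(\alpha+\beta)}V_\mu V_\nu .$$ With $a=\sqrt\alpha$, $b=\sqrt{\alpha+\beta}-\sqrt\alpha$, it is used with the tetrad $\widehat e_A=a\,e_A+b\,V_AV$, in which $\Psi$ has the same components. Its modified Dirac equation is $$i\widehat\gamma^\mu\widehat\nabla_\mu\Psi-\sqrt\alpha\,m\Psi=0.\tag{1}$$ **The class.** Assume that there are functions $s_0,s_1,s_2:U\to\mathbb C$ such that, with $s_3=-4s_1$ and $s_4=-4s_2$,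 for every $B$, $$\nabla_B\Psi=\Big(s_0-\tfrac{mB\gamma_5}{3\sqrt{J^2}}\Big)V_B\Psi-\Big(s_0+\tfrac{imA}{\sqrt{J^2}}-\tfrac{4mB\gamma_5}{3\sqrt{J^2}}\Big)\tfrac{(A-iB\gamma_5)\gamma_B}{4\sqrt{J^2}}\Psi+\gamma_B\gamma_C\omega^C(s_1+s_2\gamma_5)\Psi+\omega_B(s_3+s_4\gamma_5)\Psi,$$ and that either $\Psi$ is given as a solution of (1), or the following equations hold on $U$: $$\dot a=0,\quad s_0=\tfrac{imA}{3\sqrt{J^2}}+\tfrac23\big(\ln\sqrt{J^2}\big)^{\bullet},\quad s_2=-\tfrac{ib}{2(a+b)},\quad b(a+b)\big(\dot V_A+2s_1\omega_A\big)=h_A{}^C\big[(3a+2b)\,\partial_Ca+a\,\partial_Cb\big].$$ **Conclusion.** $\widehat e_A$ is a $C^2$ tetrad of $\widehat g$ on $U$, and $\Psi$ is a disformally invariant solution of the Dirac operator in the following sense. 1. If $\alpha$ is constant on $U$, then $\Psi$ solves the genuine Dirac equation (constant mass term) in both metrics: $i\gamma^\mu\nabla_\mu\Psi-m\Psi=0$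 for $g$, and $i\widehat\gamma^\mu\widehat\nabla_\mu\Psi-\widehat m\Psi=0$ for $\widehat g$, with the constant mass $\widehat m=\sqrt\alpha\,m$ (so $\widehat m=m$ when $\alpha=1$). 2. If $m=0$, then $\Psi$ solves the same massless Dirac equation in both metrics: $i\gamma^\mu\nabla_\mu\Psi=0$ and $i\widehat\gamma^\mu\widehat\nabla_\mu\Psi=0$. -/

import Mathlib

open scoped Manifold ContDiff Matrix

noncomputable section

namespace Disformal

/-! ### Dirac algebra (Dirac representation, signature `(+,-,-,-)`) -/

/-- The diagonal entries of `η_{AB} = diag(1,-1,-1,-1)`. -/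
def eta : Fin 4 → ℝ := ![1, -1, -1, -1]

/-- The constant Dirac matrices `γ^A` in the Dirac representation. -/
def gam : Fin 4 → Matrix (Fin 4) (Fin 4) ℂ :=
  ![!![1, 0, 0, 0; 0, 1, 0, 0; 0, 0, -1, 0; 0, 0, 0, -1],
    !![0, 0, 0, 1; 0, 0, 1, 0; 0, -1, 0, 0; -1, 0, 0, 0],
    !![0, 0, 0, -Complex.I; 0, 0, Complex.I, 0; 0, Complex.I, 0, 0; -Complex.I, 0, 0, 0],
    !![0, 0, 1, 0; 0, 0, 0, -1; -1, 0, 0, 0; 0, 1, 0, 0]]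

/-- `γ_A = η_{AB} γ^B`. -/
def gamLow (A : Fin 4) : Matrix (Fin 4) (Fin 4) ℂ := (eta A : ℂ) • gam A

/-- `γ₅ = i γ⁰ γ¹ γ² γ³`, which is `(i/4!) ε_{ABCD} γ^A γ^B γ^C γ^D` with `ε_{0123} = 1`. -/
def gam5 : Matrix (Fin 4) (Fin 4) ℂ := Complex.I • (gam 0 * gam 1 * gam 2 * gam 3)

/-- The Levi-Civita symbol `ε_{ABCD}`, `ε_{0123} = 1` (a normalized Vandermonde product:
on the indices `0,1,2,3` it is the sign of a permutation, and zero on repetitions). -/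
def epsLow (A B C D : Fin 4) : ℝ :=
  let n : Fin 4 → ℝ := fun i => ((i : ℕ) : ℝ)
  (n B - n A) * (n C - n A) * (n D - n A) * (n C - n B) * (n D - n B) * (n D - n C) / 12

/-- `ε^{ABCD}`: all indices raised with `η`, so `ε^{0123} = -1`. -/
def epsUp (A B C D : Fin 4) : ℝ := eta A * eta B * eta C * eta D * epsLow A B C D

/-! ### Metrics, tetrads, the spin connection and the Dirac operator -/

section Geometry

variable {M : Type*} [TopologicalSpace M] [ChartedSpace (EuclideanSpace ℝ (Fin 4)) M]

variable (M) in
/-- A field of bilinear forms on the tangent spaces of the four-manifold `M`. -/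
abbrev MetricField : Type _ :=
  ∀ x : M, TangentSpace (𝓡 4) x →ₗ[ℝ] TangentSpace (𝓡 4) x →ₗ[ℝ] ℝ

variable (M) in
/-- Four vector fields `e_A`. -/
abbrev FrameField : Type _ := Fin 4 → ∀ x : M, TangentSpace (𝓡 4) x

variable (M) in
/-- A Dirac spinor field, through its components in a tetrad. -/
abbrev SpinorField : Type _ := M → Fin 4 → ℂ

/-- `e` is a tetrad for `g` on `U`: four `C²` vector fields with `g(e_A, e_B) = η_{AB}`.
As `M` has dimension four, this makes `g` on `U` a symmetric non-degenerate `C²` tensor field of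
signature `(+,-,-,-)`. -/
def IsTetrad [IsManifold (𝓡 4) ∞ M] (U : Set M) (g : MetricField M) (e : FrameField M) : Prop :=
  (∀ A, ContMDiffOn (𝓡 4) (𝓡 4).tangent 2
    (fun x => (⟨x, e A x⟩ : TangentBundle (𝓡 4) M)) U) ∧
  ∀ x ∈ U, ∀ A B, g x (e A x) (e B x) = if A = B then eta A else 0

/-- `∂_A f = e_A(f)`, the derivative of `f` along `e_A`. -/
def frameDeriv {F : Type*} [NormedAddCommGroup F] [NormedSpace ℝ F]
    (e : FrameField M) (A : Fin 4) (f : M → F) (x : M) : F :=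
  mfderiv (𝓡 4) 𝓘(ℝ, F) f x (e A x)

/-- `C_{ABC} = e_{νA} (e^μ_C ∂_μ e^ν_B - e^μ_B ∂_μ e^ν_C) = g(e_A, [e_C, e_B])`. -/
def structureCoeff (g : MetricField M) (e : FrameField M) (A B C : Fin 4) (x : M) : ℝ :=
  g x (e A x) (VectorField.mlieBracket (𝓡 4) (e C) (e B) x)

/-- The coefficients of the Levi-Civita connection of `g` in the tetrad,
`γ_{ABC} = ½ (C_{ABC} - C_{BAC} - C_{CAB}) = g(e_A, ∇_{e_C} e_B)`. -/
def spinCoeff (g : MetricField M) (e : FrameField M) (A B C : Fin 4) (x : M) : ℝ :=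
  (structureCoeff g e A B C x - structureCoeff g e B A C x - structureCoeff g e C A B x) / 2

/-- The Fock-Ivanenko connection `Γ_A = -⅛ γ_{BCA} [γ^B, γ^C]`. -/
def fockIvanenko (g : MetricField M) (e : FrameField M) (A : Fin 4) (x : M) :
    Matrix (Fin 4) (Fin 4) ℂ :=
  (-(1 / 8) : ℂ) • ∑ B, ∑ C, (spinCoeff g e B C A x : ℂ) • (gam B * gam C - gam C * gam B)

/-- The covariant derivative of a spinor field, `∇_A Ψ = ∂_A Ψ - Γ_A Ψ`. -/
def covDeriv (g : MetricField M) (e : FrameField M) (A : Fin 4) (Ψ : SpinorField M) (x : M) :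
    Fin 4 → ℂ :=
  frameDeriv e A Ψ x - fockIvanenko g e A x *ᵥ Ψ x

/-- `γ^A ∇_A Ψ`. -/
def diracOp (g : MetricField M) (e : FrameField M) (Ψ : SpinorField M) (x : M) : Fin 4 → ℂ :=
  ∑ A, gam A *ᵥ covDeriv g e A Ψ x

/-- The Dirac equation `i γ^μ ∇_μ Ψ - μ Ψ = 0` on `U`, written in the metric `g` with tetrad `e`;
the mass term `μ` may depend on the point. -/
def DiracEquation (U : Set M) (g : MetricField M) (e : FrameField M) (μ : M → ℝ)
    (Ψ : SpinorField M) : Prop :=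
  ∀ x ∈ U, Complex.I • diracOp g e Ψ x - (μ x : ℂ) • Ψ x = 0

/-- `e` is a tetrad of the metric `g` on `U`, and `Ψ`, written in it, solves there the Dirac
equation of `g` with the constant mass `m`. -/
def SolvesDirac [IsManifold (𝓡 4) ∞ M] (U : Set M) (g : MetricField M) (e : FrameField M)
    (m : ℝ) (Ψ : SpinorField M) : Prop :=
  IsTetrad U g e ∧ DiracEquation U g e (fun _ => m) Ψ

/-! ### Bilinears and kinematics of the Dirac current -/

/-- The scalar `Ψ̄ Ψ`. -/
def scalA (Ψ : SpinorField M) (x : M) : ℝ := (star (Ψ x) ⬝ᵥ (gam 0 *ᵥ Ψ x)).re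

/-- The scalar `i Ψ̄ γ₅ Ψ`. -/
def scalB (Ψ : SpinorField M) (x : M) : ℝ :=
  (Complex.I * (star (Ψ x) ⬝ᵥ ((gam 0 * gam5) *ᵥ Ψ x))).re

/-- The tetrad components `J^A = Ψ̄ γ^A Ψ` of the Dirac current. -/
def current (Ψ : SpinorField M) (A : Fin 4) (x : M) : ℝ :=
  (star (Ψ x) ⬝ᵥ ((gam 0 * gam A) *ᵥ Ψ x)).re

/-- `J² = η_{AB} J^A J^B`. -/
def currentSq (Ψ : SpinorField M) (x : M) : ℝ := ∑ A, eta A * current Ψ A x ^ 2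

/-- `√J²`. -/
def currentNorm (Ψ : SpinorField M) (x : M) : ℝ := √(currentSq Ψ x)

/-- `V^A = J^A / √J²`. -/
def vUp (Ψ : SpinorField M) (A : Fin 4) (x : M) : ℝ := current Ψ A x / currentNorm Ψ x

/-- `V_A`. -/
def vLow (Ψ : SpinorField M) (A : Fin 4) (x : M) : ℝ := eta A * vUp Ψ A x

/-- The vector field `V = V^A e_A`. -/
def vField (e : FrameField M) (Ψ : SpinorField M) (x : M) : TangentSpace (𝓡 4) x :=
  ∑ A, vUp Ψ A x • e A x

/-- `f^• = V^A ∂_A f`. -/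
def dotDeriv (e : FrameField M) (Ψ : SpinorField M) (f : M → ℝ) (x : M) : ℝ :=
  ∑ A, vUp Ψ A x * frameDeriv e A f x

/-- `∇_N V_K = g(e_K, ∇_{e_N} V)`. -/
def nablaV (g : MetricField M) (e : FrameField M) (Ψ : SpinorField M) (N K : Fin 4) (x : M) : ℝ :=
  frameDeriv e N (vLow Ψ K) x + ∑ L, spinCoeff g e K L N x * vUp Ψ L x

/-- The acceleration `V^•_A = V^N ∇_N V_A`. -/
def acceleration (g : MetricField M) (e : FrameField M) (Ψ : SpinorField M) (A : Fin 4) (x : M) :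
    ℝ :=
  ∑ N, vUp Ψ N x * nablaV g e Ψ N A x

/-- The projector `h_A{}^C = δ_A^C - V_A V^C`. -/
def proj (Ψ : SpinorField M) (A C : Fin 4) (x : M) : ℝ :=
  (if A = C then 1 else 0) - vLow Ψ A x * vUp Ψ C x

/-- The vorticity tensor `ω_{BC} = ½ h_B{}^K h_C{}^N (∇_N V_K - ∇_K V_N)`. -/
def vorticityTensor (g : MetricField M) (e : FrameField M) (Ψ : SpinorField M) (B C : Fin 4)
    (x : M) : ℝ :=
  (∑ K, ∑ N, proj Ψ B K x * proj Ψ C N x * (nablaV g e Ψ N K x - nablaV g e Ψ K N x)) / 2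

/-- The vorticity vector `ω^A = -½ ε^{ABCD} ω_{BC} V_D`. -/
def vorticity (g : MetricField M) (e : FrameField M) (Ψ : SpinorField M) (A : Fin 4) (x : M) : ℝ :=
  -(∑ B, ∑ C, ∑ D, epsUp A B C D * vorticityTensor g e Ψ B C x * vLow Ψ D x) / 2

/-- `ω_A`. -/
def vorticityLow (g : MetricField M) (e : FrameField M) (Ψ : SpinorField M) (A : Fin 4) (x : M) :
    ℝ :=
  eta A * vorticity g e Ψ A x

/-! ### The disformal metric and its tetrad -/

/-- The disformal metric: the covariant form
`ĝ_{μν} = g_{μν}/α - β/(α(α+β)) V_μ V_ν` of `ĝ^{μν} = α g^{μν} + β V^μ V^ν`. -/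
def disfMetric (α β : M → ℝ) (g : MetricField M) (e : FrameField M) (Ψ : SpinorField M) :
    MetricField M := fun x =>
  (1 / α x) • g x -
    (β x / (α x * (α x + β x))) •
      (g x (vField e Ψ x)).smulRight (g x (vField e Ψ x))

/-- The tetrad coefficient `a`, with `α = a²`. -/
def coefA (α : M → ℝ) (x : M) : ℝ := √(α x)

/-- The tetrad coefficient `b`, with `β = b (b + 2a)` and `a + b > 0`. -/
def coefB (α β : M → ℝ) (x : M) : ℝ := √(α x + β x) - √(α x)

/-- The disformal tetrad `ê_A = a e_A + b V_A V`. -/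
def disfTetrad (α β : M → ℝ) (e : FrameField M) (Ψ : SpinorField M) : FrameField M := fun A x =>
  coefA α x • e A x + (coefB α β x * vLow Ψ A x) • vField e Ψ x

/-! ### The class of spinors -/

/-- `c + d γ₅`. -/
def cliff (c d : ℂ) : Matrix (Fin 4) (Fin 4) ℂ := c • (1 : Matrix (Fin 4) (Fin 4) ℂ) + d • gam5

/-- `γ_C ω^C`. -/
def vorticitySlash (g : MetricField M) (e : FrameField M) (Ψ : SpinorField M) (x : M) :
    Matrix (Fin 4) (Fin 4) ℂ :=
  ∑ C, (vorticity g e Ψ C x : ℂ) • gamLow C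

/-- The generalized Inomata condition for a spinor of mass `m` with coefficients `s₀, …, s₄`:
`∇_B Ψ = (s₀ - mBγ₅/(3√J²)) V_B Ψ
  - (s₀ + imA/√J² - 4mBγ₅/(3√J²)) (A - iBγ₅) γ_B/(4√J²) Ψ
  + γ_B γ_C ω^C (s₁ + s₂γ₅) Ψ + ω_B (s₃ + s₄γ₅) Ψ`. -/
def InomataCondition (U : Set M) (g : MetricField M) (e : FrameField M) (m : ℝ)
    (s₀ s₁ s₂ s₃ s₄ : M → ℂ) (Ψ : SpinorField M) : Prop :=
  ∀ x ∈ U, ∀ B : Fin 4,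
    let j : ℂ := (currentNorm Ψ x : ℂ)
    let a₀ : ℂ := (scalA Ψ x : ℂ)
    let b₀ : ℂ := (scalB Ψ x : ℂ)
    covDeriv g e B Ψ x =
      (vLow Ψ B x : ℂ) • (cliff (s₀ x) (-(m * b₀ / (3 * j))) *ᵥ Ψ x)
      - (1 / (4 * j)) •
        ((cliff (s₀ x + Complex.I * m * a₀ / j) (-(4 * m * b₀ / (3 * j))) *
          cliff a₀ (-(Complex.I * b₀)) * gamLow B) *ᵥ Ψ x)
      + (gamLow B * vorticitySlash g e Ψ x * cliff (s₁ x) (s₂ x)) *ᵥ Ψ x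
      + (vorticityLow g e Ψ B x : ℂ) • (cliff (s₃ x) (s₄ x) *ᵥ Ψ x)

/-- The equations that fit the coefficients `s₀, s₁, s₂` to the disformal map:
`a^• = 0`, `s₀ = imA/(3√J²) + ⅔ (ln √J²)^•`, `s₂ = -ib/(2(a+b))` and
`b(a+b) (V^•_A + 2 s₁ ω_A) = h_A{}^C ((3a+2b) ∂_C a + a ∂_C b)`. -/
def MatchingConditions (U : Set M) (g : MetricField M) (e : FrameField M) (α β : M → ℝ) (m : ℝ)
    (s₀ s₁ s₂ : M → ℂ) (Ψ : SpinorField M) : Prop :=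
  ∀ x ∈ U,
    let a : ℝ := coefA α x
    let b : ℝ := coefB α β x
    dotDeriv e Ψ (coefA α) x = 0 ∧
    s₀ x = Complex.I * m * scalA Ψ x / (3 * currentNorm Ψ x)
      + (2 / 3) * (dotDeriv e Ψ (fun y => Real.log (currentNorm Ψ y)) x : ℂ) ∧
    s₂ x = -(Complex.I * b / (2 * (a + b))) ∧
    ∀ A : Fin 4,
      ((b * (a + b) : ℝ) : ℂ) *
          ((acceleration g e Ψ A x : ℂ) + 2 * s₁ x * (vorticityLow g e Ψ A x : ℂ)) =
        ((∑ C, proj Ψ A C x *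
          ((3 * a + 2 * b) * frameDeriv e C (coefA α) x
            + a * frameDeriv e C (coefB α β) x) : ℝ) : ℂ)

/-- The modified Dirac equation `i γ̂^μ ∇̂_μ Ψ - √α m Ψ = 0` of the disformal metric. -/
def ModifiedDiracEquation (U : Set M) (g : MetricField M) (e : FrameField M) (α β : M → ℝ)
    (m : ℝ) (Ψ : SpinorField M) : Prop :=
  DiracEquation U (disfMetric α β g e Ψ) (disfTetrad α β e Ψ) (fun x => √(α x) * m) Ψ

/-- The class of spinors: `Ψ` obeys the generalized Inomata condition with `s₃ = -4 s₁`,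
`s₄ = -4 s₂`, and either is given as a solution of the modified Dirac equation of the disformal
metric, or its coefficients satisfy the matching conditions. -/
def InDisformalClass (U : Set M) (g : MetricField M) (e : FrameField M) (α β : M → ℝ) (m : ℝ)
    (Ψ : SpinorField M) : Prop :=
  ∃ s₀ s₁ s₂ : M → ℂ,
    InomataCondition U g e m s₀ s₁ s₂ (fun x => -4 * s₁ x) (fun x => -4 * s₂ x) Ψ ∧
    (ModifiedDiracEquation U g e α β m Ψ ∨ MatchingConditions U g e α β m s₀ s₁ s₂ Ψ)

/-- `Ψ` solves the genuine (constant mass) Dirac equation in the target metric, with mass `m`, and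
in the disformal metric, with mass `m'`. -/
def DisformallyInvariantSolution [IsManifold (𝓡 4) ∞ M] (U : Set M) (g : MetricField M)
    (e : FrameField M) (α β : M → ℝ) (m m' : ℝ) (Ψ : SpinorField M) : Prop :=
  SolvesDirac U g e m Ψ ∧
  SolvesDirac U (disfMetric α β g e Ψ) (disfTetrad α β e Ψ) m' Ψ

end Geometry

end Disformal

end

/-! Write `a`, `b` for `coefA`, `coefB`, `D` and `D̂` for the Dirac operators `γ^A ∇_A` of `g` and
of the disformal metric, `v̸ = γ^A V_A`, `ω̸ = γ_C ω^C`, and `θ = ∇_A V^A` for the expansion.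

**The target metric.** A spinor obeying the Inomata condition with `s₃ = -4 s₁`, `s₄ = -4 s₂`
already solves `DΨ = -imΨ` (`diracOp_of_inomata`). Contracting the condition with `γ^B`, the two
vorticity terms cancel because `γ^B γ_B = 4`, and the other two collapse because
`v̸Ψ = (A + iBγ₅)Ψ/√J²` and `J² = A² + B²`, the Fierz identities `slashV_mulVec` and
`currentSq_eq`. This part uses neither `α` nor `β`.

**Comparing the two operators.** By the product rule `gam_mul_commutator` for `γ^A [γ^B, γ^C]`,
the spin connection enters a Dirac operator only through the trace `η^{AA} C_{ACA}` and the
totally antisymmetric part `ε^{DABC} C_{ABC}` of the structure coefficients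
(`neg_sum_gam_mul_connMat`). The structure coefficients of the disformal tetrad follow from the
Leibniz rule for Lie brackets (`structureAt_disf`). Computing their trace and antisymmetric part
gives `D̂Ψ = a DΨ + b v̸ ∇_V Ψ + ½ y_C γ^C Ψ + (i b² / (2(a+b))) ω̸ γ₅ Ψ` (`diracOp_disf`), where
`y`, called `diracShift`, is built from the acceleration, the expansion and the gradients of `a`
and `b`.

**The matching conditions.** They are what makes everything after `a DΨ` vanish. The equation for
the acceleration together with `a^• = 0` says `y_C = b θ V_C - 2 b s₁ ω_C`; conservation of the
current, a consequence of `DΨ = -imΨ` with real `m`, gives `θ = -(ln √J²)^•`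
(`sum_eta_nablaV_eq`); and the Inomata condition contracted with `V`, with the prescribed `s₀`,
gives `∇_V Ψ = ½ (ln √J²)^• Ψ + v̸ ω̸ (s₁ + s₂ γ₅) Ψ`. Since `v̸² = 1`, the `v̸` terms cancel,
then the `s₁` terms, and the two `ω̸ γ₅` terms cancel for the prescribed `s₂`. Hence
`D̂Ψ = -i a m Ψ`, the modified Dirac equation (`modifiedDirac_of_matching`), which in the other
alternative is the hypothesis.

**The mass.** The mass term of the modified equation is `√α m`: a constant if `α` is one, and zero
if `m = 0`. -/

noncomputable section

namespace Disformal

/-! ### The Clifford algebra of the Dirac matrices -/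

theorem eta_mul_self (A : Fin 4) : eta A * eta A = 1 := by
  fin_cases A <;> simp [eta]

theorem gam_zero_mulVec (w : Fin 4 → ℂ) : gam 0 *ᵥ w = ![w 0, w 1, -w 2, -w 3] := by
  ext i; fin_cases i <;> simp [gam, Matrix.mulVec, dotProduct, Fin.sum_univ_four]

theorem gam_one_mulVec (w : Fin 4 → ℂ) : gam 1 *ᵥ w = ![w 3, w 2, -w 1, -w 0] := by
  ext i; fin_cases i <;> simp [gam, Matrix.mulVec, dotProduct, Fin.sum_univ_four]

theorem gam_two_mulVec (w : Fin 4 → ℂ) : gam 2 *ᵥ w =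
    ![-(Complex.I * w 3), Complex.I * w 2, Complex.I * w 1, -(Complex.I * w 0)] := by
  ext i; fin_cases i <;> simp [gam, Matrix.mulVec, dotProduct, Fin.sum_univ_four]

theorem gam_three_mulVec (w : Fin 4 → ℂ) : gam 3 *ᵥ w = ![w 2, -w 3, -w 0, w 1] := by
  ext i; fin_cases i <;> simp [gam, Matrix.mulVec, dotProduct, Fin.sum_univ_four]

theorem gam5_mulVec (w : Fin 4 → ℂ) : gam5 *ᵥ w = ![w 2, w 3, w 0, w 1] := by
  rw [gam5, Matrix.smul_mulVec, ← Matrix.mulVec_mulVec, ← Matrix.mulVec_mulVec,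
    ← Matrix.mulVec_mulVec, gam_three_mulVec, gam_two_mulVec, gam_one_mulVec, gam_zero_mulVec]
  ext i
  fin_cases i <;> simp [← mul_assoc]

theorem gam5_mul_gam5 : gam5 * gam5 = 1 := by
  refine Matrix.ext_of_mulVec_single fun i => ?_
  generalize (Pi.single i 1 : Fin 4 → ℂ) = w
  rw [← Matrix.mulVec_mulVec, gam5_mulVec, gam5_mulVec]
  ext i; fin_cases i <;> simp

/-- The Clifford relation `γ^A γ^B + γ^B γ^A = 2 η^{AB}`. -/
theorem gam_mul_gam_add (A B : Fin 4) :
    gam A * gam B + gam B * gam A =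
      ((if A = B then 2 * eta A else 0 : ℝ) : ℂ) • (1 : Matrix (Fin 4) (Fin 4) ℂ) := by
  refine Matrix.ext_of_mulVec_single fun i => ?_
  generalize (Pi.single i 1 : Fin 4 → ℂ) = w
  rw [Matrix.add_mulVec, ← Matrix.mulVec_mulVec, ← Matrix.mulVec_mulVec]
  fin_cases A <;> fin_cases B <;>
  simp only [Fin.zero_eta, Fin.mk_one, Fin.reduceFinMk, gam_zero_mulVec, gam_one_mulVec,
    gam_two_mulVec, gam_three_mulVec] <;>
  ext i <;> fin_cases i <;> simp [eta, ← mul_assoc, Matrix.smul_mulVec, Matrix.neg_mulVec] <;> ring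

set_option maxHeartbeats 4000000 in
/-- A product of three Dirac matrices splits into a vector part and an axial part. The identity
depends on the normalizations `γ₅ = iγ⁰γ¹γ²γ³` and `ε_{0123} = 1`. -/
theorem gam_mul_commutator (A B C : Fin 4) :
    gam A * (gam B * gam C - gam C * gam B) =
      (2 * (if A = B then eta A else 0 : ℝ) : ℂ) • gam C
      - (2 * (if A = C then eta A else 0 : ℝ) : ℂ) • gam B +
      (2 * Complex.I) • ∑ D, (epsUp D A B C : ℂ) • (gamLow D * gam5) := by
  -- both sides act on a generic spinor `w`, where products of matrices need no expansion
  refine Matrix.ext_of_mulVec_single fun i => ?_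
  generalize (Pi.single i 1 : Fin 4 → ℂ) = w
  simp only [Matrix.add_mulVec, Matrix.sub_mulVec, Matrix.smul_mulVec, Matrix.mul_sub,
    Fin.sum_univ_four, gamLow, ← Matrix.mulVec_mulVec]
  rw [gam5_mulVec]
  fin_cases A <;> fin_cases B <;> fin_cases C <;>
  simp only [Fin.zero_eta, Fin.mk_one, Fin.reduceFinMk, gam_zero_mulVec, gam_one_mulVec,
    gam_two_mulVec, gam_three_mulVec] <;>
  norm_num [eta, epsUp, epsLow, -Matrix.vecCons_inj] <;>
  (ext i; fin_cases i <;> simp [← mul_assoc] <;> ring_nf <;> simp)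

/-- The product rule `gam_mul_commutator` summed against a spin connection `w A B C`: only a trace
of `w` and its totally antisymmetric part survive. -/
theorem sum_smul_gam_mul_commutator (w : Fin 4 → Fin 4 → Fin 4 → ℝ) :
    ∑ A, ∑ B, ∑ C, (w A B C : ℂ) • (gam A * (gam B * gam C - gam C * gam B)) =
      ∑ C, ((2 * ∑ A, eta A * (w A A C - w A C A) : ℝ) : ℂ) • gam C +
      (2 * Complex.I) • ∑ D, ((∑ A, ∑ B, ∑ C, epsUp D A B C * w A B C : ℝ) : ℂ) •
        (gamLow D * gam5) := by
  have h1 : ∑ A, ∑ B, ∑ C, ((w A B C : ℂ) * (2 * (if A = B then eta A else 0 : ℝ) : ℂ)) • gam C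
      = ∑ C, ((2 * ∑ A, eta A * w A A C : ℝ) : ℂ) • gam C := by
    rw [Finset.sum_congr rfl fun A _ => Finset.sum_comm, Finset.sum_comm]
    refine Finset.sum_congr rfl fun C _ => ?_
    simp_rw [← Finset.sum_smul]
    congr 1
    push_cast
    rw [Finset.mul_sum]
    refine Finset.sum_congr rfl fun A _ => ?_
    rw [Finset.sum_eq_single A (by intro B _ h; simp [h.symm]) (by simp)]
    simp; ring
  have h2 : ∑ A, ∑ B, ∑ C, ((w A B C : ℂ) * (2 * (if A = C then eta A else 0 : ℝ) : ℂ)) • gam B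
      = ∑ C, ((2 * ∑ A, eta A * w A C A : ℝ) : ℂ) • gam C := by
    rw [Finset.sum_comm]
    refine Finset.sum_congr rfl fun C _ => ?_
    simp_rw [← Finset.sum_smul]
    congr 1
    push_cast
    rw [Finset.mul_sum]
    refine Finset.sum_congr rfl fun A _ => ?_
    rw [Finset.sum_eq_single A (by intro B _ h; simp [h.symm]) (by simp)]
    simp; ring
  have h3 : ∑ A, ∑ B, ∑ C, ((w A B C : ℂ) * (2 * Complex.I)) •
        ∑ D, (epsUp D A B C : ℂ) • (gamLow D * gam5) =
      (2 * Complex.I) • ∑ D, ((∑ A, ∑ B, ∑ C, epsUp D A B C * w A B C : ℝ) : ℂ) •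
        (gamLow D * gam5) := by
    push_cast
    simp_rw [Finset.smul_sum, Finset.sum_smul, Finset.smul_sum]
    symm
    rw [Finset.sum_comm]
    refine Finset.sum_congr rfl fun A _ => ?_
    rw [Finset.sum_comm]
    refine Finset.sum_congr rfl fun B _ => ?_
    rw [Finset.sum_comm]
    refine Finset.sum_congr rfl fun C _ => Finset.sum_congr rfl fun D _ => ?_
    simp only [smul_smul]
    congr 1
    ring
  simp_rw [gam_mul_commutator, smul_add, smul_sub, smul_smul, Finset.sum_add_distrib,
    Finset.sum_sub_distrib, h1, h2, h3, ← Finset.sum_sub_distrib, ← sub_smul]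
  congr 1
  refine Finset.sum_congr rfl fun C _ => ?_
  congr 1
  rw [← Complex.ofReal_sub, ← mul_sub, ← Finset.sum_sub_distrib]
  simp_rw [mul_sub]

theorem cliff_mul_cliff (a b c d : ℂ) :
    cliff a b * cliff c d = cliff (a * c + b * d) (a * d + b * c) := by
  simp only [cliff, add_mul, mul_add, Matrix.smul_mul, Matrix.mul_smul, one_mul, mul_one,
    gam5_mul_gam5]
  module

theorem smul_cliff (k c d : ℂ) : k • cliff c d = cliff (k * c) (k * d) := by
  simp only [cliff]; module

theorem cliff_sub_cliff (a b c d : ℂ) : cliff a b - cliff c d = cliff (a - c) (b - d) := by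
  simp only [cliff]; module

theorem cliff_zero (a : ℂ) : cliff a 0 = a • 1 := by simp [cliff]

theorem gam5_mul_gam (A : Fin 4) : gam5 * gam A = -(gam A * gam5) := by
  refine Matrix.ext_of_mulVec_single fun i => ?_
  generalize (Pi.single i 1 : Fin 4 → ℂ) = w
  rw [Matrix.neg_mulVec, ← Matrix.mulVec_mulVec, ← Matrix.mulVec_mulVec]
  fin_cases A <;> simp only [Fin.zero_eta, Fin.mk_one, Fin.reduceFinMk, gam_zero_mulVec,
    gam_one_mulVec, gam_two_mulVec, gam_three_mulVec, gam5_mulVec] <;>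
  ext i <;> fin_cases i <;> simp

theorem gam_mul_cliff (A : Fin 4) (c d : ℂ) : gam A * cliff c d = cliff c (-d) * gam A := by
  simp only [cliff, add_mul, mul_add, Matrix.smul_mul, Matrix.mul_smul, one_mul, mul_one,
    gam5_mul_gam, smul_neg, neg_smul, neg_neg, neg_mul]

theorem gam_mul_gamLow (A : Fin 4) : gam A * gamLow A = 1 := by
  have h := gam_mul_gam_add A A
  rw [if_pos rfl, ← two_smul ℂ] at h
  have h2 : gam A * gam A = (eta A : ℂ) • (1 : Matrix (Fin 4) (Fin 4) ℂ) := by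
    have := congrArg (fun N => (1 / 2 : ℂ) • N) h
    simp only [smul_smul] at this
    norm_num at this
    rw [this]; congr 1; ring
  rw [gamLow, Matrix.mul_smul, h2, smul_smul, ← Complex.ofReal_mul, eta_mul_self]
  simp

theorem sum_gam_mul_gamLow : ∑ A, gam A * gamLow A = (4 : ℂ) • 1 := by
  simp only [gam_mul_gamLow, Fin.sum_univ_four]
  module

/-- Lowering an index with `η`: `v_A = η_{AB} v^B`. -/
def lower (v : Fin 4 → ℝ) (A : Fin 4) : ℝ := eta A * v A

theorem sum_lower_gam_mul_self {v : Fin 4 → ℝ} (hv : ∑ A, v A * lower v A = 1) :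
    (∑ A, (lower v A : ℂ) • gam A) * ∑ A, (lower v A : ℂ) • gam A = 1 := by
  have h₁ : (∑ A, (lower v A : ℂ) • gam A) * ∑ A, (lower v A : ℂ) • gam A =
      ∑ A, ∑ B, ((lower v A : ℂ) * lower v B) • (gam A * gam B) := by
    simp only [Finset.sum_mul_sum, Matrix.smul_mul, Matrix.mul_smul, smul_smul]
    refine Fintype.sum_congr _ _ fun A => Fintype.sum_congr _ _ fun B => ?_
    rw [mul_comm (lower v B : ℂ)]
  have h₂ : ∑ A, ∑ B, ((lower v A : ℂ) * lower v B) • (gam B * gam A) =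
      ∑ A, ∑ B, ((lower v A : ℂ) * lower v B) • (gam A * gam B) := by
    rw [Finset.sum_comm]
    refine Fintype.sum_congr _ _ fun A => Fintype.sum_congr _ _ fun B => ?_
    rw [mul_comm (lower v B : ℂ)]
  have h : (2 : ℂ) • ((∑ A, (lower v A : ℂ) • gam A) * ∑ A, (lower v A : ℂ) • gam A) =
      ∑ A, ∑ B, ((lower v A : ℂ) * lower v B) • (gam A * gam B + gam B * gam A) := by
    simp only [smul_add, Finset.sum_add_distrib]
    rw [h₁, h₂, two_smul]
  have h' : ∑ A, ∑ B, ((lower v A : ℂ) * lower v B) • (gam A * gam B + gam B * gam A) =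
      (2 : ℂ) • (1 : Matrix (Fin 4) (Fin 4) ℂ) := by
    simp only [gam_mul_gam_add, smul_smul, ← Finset.sum_smul]
    congr 1
    have : ∀ A, ∑ B, (lower v A : ℂ) * lower v B * ((if A = B then 2 * eta A else 0 : ℝ) : ℂ) =
        ((2 * (v A * lower v A) : ℝ) : ℂ) := fun A => by
      rw [Finset.sum_eq_single A (by intro B _ h; simp [h.symm]) (by simp), if_pos rfl]
      have := eta_mul_self A
      norm_cast
      rw [lower]
      linear_combination 2 * v A * v A * eta A * this
    simp only [this]
    rw [← Complex.ofReal_sum, ← Finset.mul_sum, hv]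
    norm_num
  rw [h'] at h
  exact smul_right_injective _ (two_ne_zero (α := ℂ)) h

/-! ### Fierz identities and reality of the bilinears -/

section
variable {M : Type*} {Ψ : SpinorField M}

/-- The Fierz identity `J² = A² + B²`. -/
theorem currentSq_eq (x : M) : currentSq Ψ x = scalA Ψ x ^ 2 + scalB Ψ x ^ 2 := by
  simp only [currentSq, scalA, scalB, current, Fin.sum_univ_four, ← Matrix.mulVec_mulVec,
    gam_zero_mulVec, gam_one_mulVec, gam_two_mulVec, gam_three_mulVec, gam5_mulVec]
  generalize Ψ x = w
  simp only [dotProduct, Fin.sum_univ_four, eta, Pi.star_apply, Complex.star_def]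
  simp
  ring

theorem currentNorm_sq (x : M) : currentNorm Ψ x ^ 2 = scalA Ψ x ^ 2 + scalB Ψ x ^ 2 := by
  rw [currentNorm, currentSq_eq]; exact Real.sq_sqrt (by positivity)

/-- The Fierz identity `J^A γ_A Ψ = (A + iBγ₅)Ψ`. -/
theorem current_slash_mulVec (x : M) :
    (∑ A, (current Ψ A x : ℂ) • gamLow A) *ᵥ Ψ x =
      cliff (scalA Ψ x) (Complex.I * scalB Ψ x) *ᵥ Ψ x := by
  simp only [scalA, scalB, current, Fin.sum_univ_four, cliff, gamLow, Matrix.add_mulVec,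
    Matrix.smul_mulVec, Matrix.one_mulVec, ← Matrix.mulVec_mulVec,
    gam_zero_mulVec, gam_one_mulVec, gam_two_mulVec, gam_three_mulVec, gam5_mulVec]
  generalize Ψ x = w
  simp only [dotProduct, Fin.sum_univ_four, eta, Pi.star_apply, Complex.star_def]
  ext i
  fin_cases i <;> simp [Complex.ext_iff] <;> constructor <;> ring

end

/-- The form `(w, z) ↦ w̄ γ^A z` is Hermitian. -/
theorem current_sesquilinear (A : Fin 4) (w z : Fin 4 → ℂ) :
    star (star w ⬝ᵥ ((gam 0 * gam A) *ᵥ z)) = star z ⬝ᵥ ((gam 0 * gam A) *ᵥ w) := by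
  simp only [← Matrix.mulVec_mulVec]
  fin_cases A <;> simp only [Fin.zero_eta, Fin.mk_one, Fin.reduceFinMk, gam_zero_mulVec,
    gam_one_mulVec,
    gam_two_mulVec, gam_three_mulVec] <;>
  simp [dotProduct, Fin.sum_univ_four, Complex.ext_iff] <;> (try constructor) <;> ring

/-- The axial current is real. Hence the axial part of the spin connection, which enters the Dirac
operator with a factor `i`, does not contribute to the divergence of the Dirac current. -/
theorem axial_real (D : Fin 4) (w : Fin 4 → ℂ) :
    (star w ⬝ᵥ ((gam 0 * (gamLow D * gam5)) *ᵥ w)).im = 0 := by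
  simp only [← Matrix.mulVec_mulVec, gamLow, Matrix.smul_mulVec]
  fin_cases D <;> simp only [Fin.zero_eta, Fin.mk_one, Fin.reduceFinMk, gam_zero_mulVec,
    gam_one_mulVec, gam_two_mulVec, gam_three_mulVec, gam5_mulVec] <;>
  simp [dotProduct, Fin.sum_univ_four, eta] <;> ring

theorem scalar_real (w : Fin 4 → ℂ) :
    (star w ⬝ᵥ (gam 0 *ᵥ w)).im = 0 := by
  simp only [gam_zero_mulVec]
  simp [dotProduct, Fin.sum_univ_four]
  ring

/-! ### Contractions of structure coefficients -/

/-- The Levi-Civita connection coefficients `½ (c_{ABC} - c_{BAC} - c_{CAB})` of an orthonormal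
frame with structure coefficients `c`. Here and below `c`, a vector `v` and the derivatives of all
functions involved are plain arrays of numbers, their values at one point. -/
def connCoeff (c : Fin 4 → Fin 4 → Fin 4 → ℝ) (A B C : Fin 4) : ℝ :=
  (c A B C - c B A C - c C A B) / 2

/-- The Fock–Ivanenko matrices `-⅛ γ_{BCA} [γ^B, γ^C]` of the structure coefficients `c`. -/
def connMat (c : Fin 4 → Fin 4 → Fin 4 → ℝ) (A : Fin 4) : Matrix (Fin 4) (Fin 4) ℂ :=
  (-(1 / 8) : ℂ) • ∑ B, ∑ C, (connCoeff c B C A : ℂ) • (gam B * gam C - gam C * gam B)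

theorem sum_epsUp_zero (f : Fin 4 → Fin 4 → Fin 4 → ℝ) :
    ∑ A, ∑ B, ∑ C, epsUp 0 A B C * f A B C =
      -(f 1 2 3 - f 1 3 2 + f 2 3 1 - f 2 1 3 + f 3 1 2 - f 3 2 1) := by
  simp [Fin.sum_univ_four, epsUp, epsLow, eta]
  ring

theorem sum_epsUp_one (f : Fin 4 → Fin 4 → Fin 4 → ℝ) :
    ∑ A, ∑ B, ∑ C, epsUp 1 A B C * f A B C =
      (f 0 2 3 - f 0 3 2 + f 2 3 0 - f 2 0 3 + f 3 0 2 - f 3 2 0) := by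
  simp [Fin.sum_univ_four, epsUp, epsLow, eta]
  ring

theorem sum_epsUp_two (f : Fin 4 → Fin 4 → Fin 4 → ℝ) :
    ∑ A, ∑ B, ∑ C, epsUp 2 A B C * f A B C =
      -(f 0 1 3 - f 0 3 1 + f 1 3 0 - f 1 0 3 + f 3 0 1 - f 3 1 0) := by
  simp [Fin.sum_univ_four, epsUp, epsLow, eta]
  ring

theorem sum_epsUp_three (f : Fin 4 → Fin 4 → Fin 4 → ℝ) :
    ∑ A, ∑ B, ∑ C, epsUp 3 A B C * f A B C =
      (f 0 1 2 - f 0 2 1 + f 1 2 0 - f 1 0 2 + f 2 0 1 - f 2 1 0) := by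
  simp [Fin.sum_univ_four, epsUp, epsLow, eta]
  ring

/-- The contraction `v^A f_A`. -/
def contr (v f : Fin 4 → ℝ) : ℝ := ∑ A, v A * f A

/-- The derivative of a function along `a e_C + b v_C v`, when `f F` is its derivative along
`e_F`. -/
def liftDeriv (v : Fin 4 → ℝ) (a b : ℝ) (C : Fin 4) (f : Fin 4 → ℝ) : ℝ :=
  a * f C + b * lower v C * contr v f

/-- The contraction `v^G c_{AGC}` of the structure coefficients in their second index. -/
def contrMid (c : Fin 4 → Fin 4 → Fin 4 → ℝ) (v : Fin 4 → ℝ) (A C : Fin 4) : ℝ :=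
  contr v fun G => c A G C

/-- The contraction `v^E c_{EBC}` of the structure coefficients in their first index. -/
def contrFst (c : Fin 4 → Fin 4 → Fin 4 → ℝ) (v : Fin 4 → ℝ) (B C : Fin 4) : ℝ :=
  contr v fun E => c E B C

/-- The contraction `v^E v^G c_{EGC}` of the structure coefficients in their first two indices. -/
def contrTwo (c : Fin 4 → Fin 4 → Fin 4 → ℝ) (v : Fin 4 → ℝ) (C : Fin 4) : ℝ :=
  contr v fun E => contrMid c v E C

/-- The structure coefficients of the disformal tetrad in terms of data of the original one: its
structure coefficients `c`, the components `v` of the unit vector field with their derivatives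
`dv N K = e_N(v_K)`, and `a`, `b` with their derivatives `da`, `db` along the tetrad. The two
summands come from `ĝ(ê_A, X) = g(e_A, X) / a + (1/(a+b) - 1/a) v_A g(v, X)`; the brackets are
those of `X = [ê_C, ê_B]`, with `g(e_A, X)` and `g(v, X)` expanded by the Leibniz rule. -/
def disfCoeff (c : Fin 4 → Fin 4 → Fin 4 → ℝ) (v : Fin 4 → ℝ) (dv : Fin 4 → Fin 4 → ℝ)
    (a b : ℝ) (da db : Fin 4 → ℝ) (A B C : Fin 4) : ℝ :=
  (1 / a) * ((liftDeriv v a b C da * if A = B then eta A else 0)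
      - (liftDeriv v a b B da * if A = C then eta A else 0)
      + (liftDeriv v a b C (fun F => db F * lower v B + b * dv F B)
        - liftDeriv v a b B (fun F => db F * lower v C + b * dv F C)) * lower v A
      + a ^ 2 * c A B C
      + a * (b * lower v B) * (dv C A + contrMid c v A C)
      - a * (b * lower v C) * (dv B A + contrMid c v A B))
  + (1 / (a + b) - 1 / a) * lower v A * (liftDeriv v a b C da * lower v B
      - liftDeriv v a b B da * lower v C
      + liftDeriv v a b C (fun F => db F * lower v B + b * dv F B)
      - liftDeriv v a b B (fun F => db F * lower v C + b * dv F C)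
      + a ^ 2 * contrFst c v B C
      + a * (b * lower v B) * contrTwo c v C
      - a * (b * lower v C) * contrTwo c v B)

theorem contr_contrFst {c : Fin 4 → Fin 4 → Fin 4 → ℝ} (hc : ∀ A B C, c A C B = -c A B C)
    (v : Fin 4 → ℝ) (C : Fin 4) : ∑ A, v A * contrFst c v C A = -contrTwo c v C := by
  simp only [contrFst, contrTwo, contrMid, contr, Finset.mul_sum]
  rw [Finset.sum_comm, ← Finset.sum_neg_distrib]
  refine Finset.sum_congr rfl fun E _ => ?_
  rw [← Finset.sum_neg_distrib]
  refine Finset.sum_congr rfl fun A _ => ?_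
  rw [hc E A C]; ring

theorem contrFst_swap {c : Fin 4 → Fin 4 → Fin 4 → ℝ} (hc : ∀ A B C, c A C B = -c A B C)
    (v : Fin 4 → ℝ) (B C : Fin 4) : contrFst c v C B = -contrFst c v B C := by
  simp only [contrFst, contr, ← Finset.sum_neg_distrib]
  refine Finset.sum_congr rfl fun E _ => ?_
  rw [hc]; ring

theorem contr_contrMid {c : Fin 4 → Fin 4 → Fin 4 → ℝ} (hc : ∀ A B C, c A C B = -c A B C)
    (v : Fin 4 → ℝ) (A : Fin 4) : ∑ C, v C * contrMid c v A C = 0 := by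
  simp only [contrMid, contr, Finset.mul_sum]
  have h : ∑ C, ∑ G, v C * (v G * c A G C) = -∑ C, ∑ G, v C * (v G * c A G C) := by
    conv_lhs => rw [Finset.sum_comm]
    simp only [← Finset.sum_neg_distrib]
    refine Finset.sum_congr rfl fun E _ => Finset.sum_congr rfl fun F _ => ?_
    rw [hc A F E]; ring
  linarith

theorem contr_contrTwo {c : Fin 4 → Fin 4 → Fin 4 → ℝ} (hc : ∀ A B C, c A C B = -c A B C)
    (v : Fin 4 → ℝ) : ∑ C, v C * contrTwo c v C = 0 := by
  simp only [contrTwo, contr, Finset.mul_sum]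
  rw [Finset.sum_comm]
  have h : ∀ E, ∑ C, v C * (v E * contrMid c v E C) = v E * ∑ C, v C * contrMid c v E C := by
    intro E; rw [Finset.mul_sum]; exact Finset.sum_congr rfl fun C _ => by ring
  simp [h, contr_contrMid hc]

theorem contr_trace (c : Fin 4 → Fin 4 → Fin 4 → ℝ) (v : Fin 4 → ℝ) :
    ∑ A, eta A * contrMid c v A A = ∑ C, v C * ∑ A, eta A * c A C A := by
  simp only [contrMid, contr, Finset.mul_sum]
  rw [Finset.sum_comm]
  exact Finset.sum_congr rfl fun _ _ => Finset.sum_congr rfl fun _ _ => by ring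

theorem sum_epsUp_connCoeff {c : Fin 4 → Fin 4 → Fin 4 → ℝ} (hc : ∀ A B C, c A C B = -c A B C)
    (D : Fin 4) :
    ∑ A, ∑ B, ∑ C, epsUp D A B C * connCoeff c B C A =
      (∑ A, ∑ B, ∑ C, epsUp D A B C * c A B C) / 2 := by
  fin_cases D <;> simp only [Fin.zero_eta, Fin.mk_one, Fin.reduceFinMk, sum_epsUp_zero,
    sum_epsUp_one, sum_epsUp_two, sum_epsUp_three, connCoeff]
  · rw [hc 1 2 3, hc 2 1 3, hc 3 1 2]; ring
  · rw [hc 0 2 3, hc 2 0 3, hc 3 0 2]; ring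
  · rw [hc 0 1 3, hc 1 0 3, hc 3 0 1]; ring
  · rw [hc 0 1 2, hc 1 0 2, hc 2 0 1]; ring

/-- The totally antisymmetric part of the disformal structure coefficients. The derivatives of `a`
and `b` do not enter: they come with `η_{AB}` or with a product of two components of `v`. -/
theorem sum_epsUp_disfCoeff (c : Fin 4 → Fin 4 → Fin 4 → ℝ)
    (v : Fin 4 → ℝ) (dv : Fin 4 → Fin 4 → ℝ)
    (a b : ℝ) (da db : Fin 4 → ℝ) (ha : a ≠ 0) (hab : a + b ≠ 0)
    (D : Fin 4) :
    ∑ A, ∑ B, ∑ C, epsUp D A B C * disfCoeff c v dv a b da db A B C =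
      a * ∑ A, ∑ B, ∑ C, epsUp D A B C * c A B C
      + 2 * b * ∑ A, ∑ B, ∑ C, epsUp D A B C *
          (lower v A * ((contrMid c v C B - contrMid c v B C - contrFst c v B C) / 2))
      + b ^ 2 / (a + b) * ∑ A, ∑ B, ∑ C, epsUp D A B C *
          (lower v A * (contrFst c v B C - 2 * dv C B)) := by
  fin_cases D <;> simp only [Fin.zero_eta, Fin.mk_one, Fin.reduceFinMk, sum_epsUp_zero,
    sum_epsUp_one, sum_epsUp_two, sum_epsUp_three] <;>
  simp only [disfCoeff, liftDeriv, Fin.reduceEq, if_false] <;> field_simp <;> ring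

/-- The trace of the disformal structure coefficients, for a unit vector `v`. The hypothesis `hdv`
is the derivative of the normalization `v^A v_A = 1`. -/
theorem trace_disfCoeff {c : Fin 4 → Fin 4 → Fin 4 → ℝ} (hc : ∀ A B C, c A C B = -c A B C)
    {v : Fin 4 → ℝ} (hv : ∑ A, v A * lower v A = 1)
    {dv : Fin 4 → Fin 4 → ℝ} (hdv : ∀ N, ∑ A, v A * dv N A = 0)
    (a b : ℝ) (da db : Fin 4 → ℝ) (ha : a ≠ 0) (hab : a + b ≠ 0) (C : Fin 4) :
    ∑ A, eta A * disfCoeff c v dv a b da db A C A =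
      a * (∑ A, eta A * c A C A) + b * contr v (fun N => dv N C)
      + b * (∑ A, eta A * (dv A A + contrMid c v A A)) * lower v C
      + da C + contr v db * lower v C - 3 * liftDeriv v a b C da / a
      - liftDeriv v a b C (fun F => da F + db F) / (a + b) := by
  have hl : ∀ A, eta A * lower v A = v A := fun A => by
    rw [lower, ← mul_assoc, eta_mul_self, one_mul]
  have hlift : ∀ f, ∑ A, v A * liftDeriv v a b A f = (a + b) * contr v f := fun f => by
    have h : ∀ A, v A * liftDeriv v a b A f =
        a * (v A * f A) + b * contr v f * (v A * lower v A) := fun A => by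
      rw [liftDeriv]; ring
    rw [Finset.sum_congr rfl fun A _ => h A, Finset.sum_add_distrib, ← Finset.mul_sum,
      ← Finset.mul_sum, hv, contr]
    ring
  have hcontr : ∀ B, contr v (fun F => db F * lower v B + b * dv F B) =
      contr v db * lower v B + b * contr v fun F => dv F B := fun B => by
    simp only [contr, mul_add, Finset.sum_add_distrib, Finset.mul_sum, Finset.sum_mul]
    congr 1 <;> exact Finset.sum_congr rfl fun _ _ => by ring
  have hdl : ∑ A, v A * liftDeriv v a b C (fun F => db F * lower v A + b * dv F A) =
      liftDeriv v a b C db := by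
    have h : ∀ A, v A * liftDeriv v a b C (fun F => db F * lower v A + b * dv F A) =
        liftDeriv v a b C db * (v A * lower v A) + a * b * (v A * dv C A) +
          b ^ 2 * lower v C * ∑ F, v F * (v A * dv F A) := fun A => by
      have : contr v (fun F => dv F A) * v A = ∑ F, v F * (v A * dv F A) := by
        rw [contr, Finset.sum_mul]; exact Finset.sum_congr rfl fun _ _ => by ring
      rw [liftDeriv, hcontr, ← this, liftDeriv]
      ring
    rw [Finset.sum_congr rfl fun A _ => h A, Finset.sum_add_distrib, Finset.sum_add_distrib,
      ← Finset.mul_sum, ← Finset.mul_sum, ← Finset.mul_sum, hv, hdv, Finset.sum_comm]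
    simp [← Finset.mul_sum, hdv]
  -- each summand is put into a form whose sum over `A` one of the rules above evaluates
  have key : ∀ A, eta A * disfCoeff c v dv a b da db A C A =
      (1 / a) * (if A = C then liftDeriv v a b A da else 0) - (1 / a) * liftDeriv v a b C da
      + (1 / (a + b)) * (v A * liftDeriv v a b A (fun F => db F * lower v C + b * dv F C))
      - (1 / (a + b)) * (v A * liftDeriv v a b C (fun F => db F * lower v A + b * dv F A))
      + a * (eta A * c A C A)
      + b * lower v C * (eta A * (dv A A + contrMid c v A A))
      - b * (v A * dv C A) - b * (v A * contrMid c v A C)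
      + (1 / (a + b) - 1 / a) * lower v C * (v A * liftDeriv v a b A da)
      - (1 / (a + b) - 1 / a) * liftDeriv v a b C da * (v A * lower v A)
      + (1 / (a + b) - 1 / a) * a ^ 2 * (v A * contrFst c v C A)
      + (1 / (a + b) - 1 / a) * a * b * lower v C * (v A * contrTwo c v A)
      - (1 / (a + b) - 1 / a) * a * b * contrTwo c v C * (v A * lower v A) := fun A => by
    rw [← hl A, disfCoeff]
    have e := eta_mul_self A
    rw [if_pos rfl]
    generalize liftDeriv v a b A (fun F => db F * lower v C + b * dv F C) = x
    generalize liftDeriv v a b C (fun F => db F * lower v A + b * dv F A) = y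
    split_ifs with h
    · subst h
      field_simp
      ring
    · field_simp
      linear_combination (-(a + b) * liftDeriv v a b C da) * e
  rw [Finset.sum_congr rfl fun A _ => key A]
  simp only [Finset.sum_add_distrib, Finset.sum_sub_distrib, ← Finset.mul_sum,
    Finset.sum_ite_eq', Finset.mem_univ, if_true, hlift, hdl, hv, hdv, contr_contrFst hc v C,
    contr_contrTwo hc v]
  have hM : ∑ A, v A * contrMid c v A C = contrTwo c v C := rfl
  rw [hM, hcontr]
  simp only [liftDeriv, Finset.sum_const, Finset.card_univ, Fintype.card_fin, nsmul_eq_mul]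
  have hs : contr v (fun F => da F + db F) = contr v da + contr v db := by
    simp only [contr, mul_add, Finset.sum_add_distrib]
  rw [hs]
  field_simp
  push_cast
  ring

/-! ### The spin connection in the Dirac operator -/

/-- The spin connection enters the Dirac operator only through the trace and the totally
antisymmetric part of the structure coefficients. -/
theorem neg_sum_gam_mul_connMat {c : Fin 4 → Fin 4 → Fin 4 → ℝ}
    (hc : ∀ A B C, c A C B = -c A B C) :
    -∑ A, gam A * connMat c A =
      (1 / 2 : ℂ) • ∑ C, ((∑ A, eta A * c A C A : ℝ) : ℂ) • gam C +
      (Complex.I / 8) • ∑ D, ((∑ A, ∑ B, ∑ C, epsUp D A B C * c A B C : ℝ) : ℂ) •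
        (gamLow D * gam5) := by
  have h1 : -∑ A, gam A * connMat c A = (1 / 8 : ℂ) • ∑ A, ∑ B, ∑ C,
      (connCoeff c B C A : ℂ) • (gam A * (gam B * gam C - gam C * gam B)) := by
    simp only [connMat, Matrix.mul_smul, Finset.mul_sum, ← Finset.smul_sum]
    rw [← neg_smul]; norm_num
  have h2 : ∀ C, (2 * ∑ A, eta A * (connCoeff c A C A - connCoeff c C A A)) =
      4 * ∑ A, eta A * c A C A := fun C => by
    rw [Finset.mul_sum, Finset.mul_sum]
    refine Finset.sum_congr rfl fun A _ => ?_
    have : c C A A = 0 := by linarith [hc C A A]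
    rw [connCoeff, connCoeff, this, hc A C A]; ring
  rw [h1, sum_smul_gam_mul_commutator fun A B C => connCoeff c B C A]
  simp only [h2, sum_epsUp_connCoeff hc, smul_add, smul_smul, Finset.smul_sum]
  congr 1 <;> refine Finset.sum_congr rfl fun C _ => ?_ <;> congr 1 <;> push_cast <;> ring

/-- The spin connection term of `v̸ ∇_v`, split like that of the Dirac operator. -/
theorem neg_lower_mul_contr_connMat {c : Fin 4 → Fin 4 → Fin 4 → ℝ}
    (hc : ∀ A B C, c A C B = -c A B C) (v : Fin 4 → ℝ) :
    -((∑ A, (lower v A : ℂ) • gam A) * ∑ E, (v E : ℂ) • connMat c E) =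
      (-1 / 2 : ℂ) • ∑ C, (contrTwo c v C : ℂ) • gam C +
      (Complex.I / 4) • ∑ D, ((∑ A, ∑ B, ∑ C, epsUp D A B C * (lower v A *
        ((contrMid c v C B - contrMid c v B C - contrFst c v B C) / 2)) : ℝ) : ℂ) •
        (gamLow D * gam5) := by
  have hw : ∀ B C, ∑ E, v E * connCoeff c B C E =
      (contrMid c v C B - contrMid c v B C - contrFst c v B C) / 2 := fun B C => by
    simp only [contrMid, contrFst, contr, ← Finset.sum_sub_distrib, Finset.sum_div]
    refine Finset.sum_congr rfl fun E _ => ?_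
    rw [connCoeff, hc B E C, hc C E B]; ring
  have h0 : ∑ E, (v E : ℂ) • connMat c E = (-(1 / 8) : ℂ) • ∑ B, ∑ C,
      ((∑ E, v E * connCoeff c B C E : ℝ) : ℂ) • (gam B * gam C - gam C * gam B) := by
    simp only [connMat, Finset.smul_sum]
    rw [Finset.sum_comm]
    refine Finset.sum_congr rfl fun B _ => ?_
    rw [Finset.sum_comm]
    refine Finset.sum_congr rfl fun C _ => ?_
    push_cast
    rw [Finset.sum_smul, Finset.smul_sum]
    refine Finset.sum_congr rfl fun E _ => ?_
    simp only [smul_smul]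
    congr 1; ring
  have h1 : -((∑ A, (lower v A : ℂ) • gam A) * ∑ E, (v E : ℂ) • connMat c E) =
      (1 / 8 : ℂ) • ∑ A, ∑ B, ∑ C, ((lower v A * ∑ E, v E * connCoeff c B C E : ℝ) : ℂ) •
        (gam A * (gam B * gam C - gam C * gam B)) := by
    rw [h0, Matrix.mul_smul, neg_smul, neg_neg, Finset.sum_mul]
    congr 1
    refine Fintype.sum_congr _ _ fun A => ?_
    simp only [Matrix.mul_sum, Matrix.smul_mul, Matrix.mul_smul, smul_smul]
    refine Fintype.sum_congr _ _ fun B => Fintype.sum_congr _ _ fun C => ?_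
    congr 1
    push_cast
    ring
  have h2 : ∀ C, 2 * ∑ A, eta A * (lower v A * ((contrMid c v C A - contrMid c v A C -
      contrFst c v A C) / 2) - lower v A * ((contrMid c v A C - contrMid c v C A -
      contrFst c v C A) / 2)) = -4 * contrTwo c v C := fun C => by
    have hQ := contr_contrMid hc v C
    have hP := contr_contrFst hc v C
    have hR : ∑ A, v A * contrMid c v A C = contrTwo c v C := rfl
    have : ∀ A, eta A * (lower v A * ((contrMid c v C A - contrMid c v A C -
      contrFst c v A C) / 2) - lower v A * ((contrMid c v A C - contrMid c v C A -
      contrFst c v C A) / 2)) = v A * contrMid c v C A - v A * contrMid c v A C +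
        v A * contrFst c v C A := fun A => by
      rw [contrFst_swap hc v C A, lower]
      linear_combination (v A * (contrMid c v C A - contrMid c v A C + contrFst c v C A)) *
        eta_mul_self A
    rw [Finset.sum_congr rfl fun A _ => this A, Finset.sum_add_distrib, Finset.sum_sub_distrib,
      hQ, hP, hR]
    ring
  rw [h1, sum_smul_gam_mul_commutator fun A B C => lower v A * ∑ E, v E * connCoeff c B C E]
  simp only [hw, h2, smul_add, smul_smul, Finset.smul_sum]
  congr 1 <;> refine Finset.sum_congr rfl fun C _ => ?_ <;> congr 1 <;> push_cast <;> ring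

theorem disfCoeff_swap {c : Fin 4 → Fin 4 → Fin 4 → ℝ}
    (hc : ∀ A B C, c A C B = -c A B C) (v : Fin 4 → ℝ) (dv : Fin 4 → Fin 4 → ℝ) (a b : ℝ)
    (da db : Fin 4 → ℝ) (A B C : Fin 4) :
    disfCoeff c v dv a b da db A C B = -disfCoeff c v dv a b da db A B C := by
  rw [disfCoeff, disfCoeff, hc A B C, contrFst_swap hc v B C]
  ring

/-- The algebraic core of the comparison of the two Dirac operators: the spin connection term of
the disformal one is `a` times the original term, plus `b` times that of `v̸ ∇_v`, plus a vector
term, plus an axial term which is a multiple of the vorticity. -/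
theorem connMat_disfCoeff {c : Fin 4 → Fin 4 → Fin 4 → ℝ} (hc : ∀ A B C, c A C B = -c A B C)
    {v : Fin 4 → ℝ} (hv : ∑ A, v A * lower v A = 1)
    {dv : Fin 4 → Fin 4 → ℝ} (hdv : ∀ N, ∑ A, v A * dv N A = 0)
    {a b : ℝ} (da db : Fin 4 → ℝ) (ha : a ≠ 0) (hab : a + b ≠ 0) :
    -∑ A, gam A * connMat (disfCoeff c v dv a b da db) A =
      -((a : ℂ) • ∑ A, gam A * connMat c A)
      - (b : ℂ) • ((∑ A, (lower v A : ℂ) • gam A) * ∑ E, (v E : ℂ) • connMat c E)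
      + (1 / 2 : ℂ) • ∑ C, ((b * (contr v (fun N => dv N C) + contrTwo c v C)
          + b * (∑ A, eta A * (dv A A + contrMid c v A A)) * lower v C
          + da C + contr v db * lower v C - 3 * liftDeriv v a b C da / a
          - liftDeriv v a b C (fun F => da F + db F) / (a + b) : ℝ) : ℂ) • gam C
      + (Complex.I * b ^ 2 / (2 * (a + b))) • ∑ D, ((∑ A, ∑ B, ∑ C, epsUp D A B C *
          (lower v A * ((contrFst c v B C - 2 * dv C B) / 4)) : ℝ) : ℂ) •
          (gamLow D * gam5) := by
  have hab' : (a : ℂ) + b ≠ 0 := by exact_mod_cast hab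
  rw [neg_sum_gam_mul_connMat (disfCoeff_swap hc v dv a b da db), ← smul_neg, sub_eq_add_neg,
    ← smul_neg, neg_sum_gam_mul_connMat hc, neg_lower_mul_contr_connMat hc v]
  simp only [sum_epsUp_disfCoeff c v dv a b da db ha hab,
    trace_disfCoeff hc hv hdv a b da db ha hab]
  have e4 : ∀ D, ∑ A, ∑ B, ∑ C, epsUp D A B C *
          (lower v A * ((contrFst c v B C - 2 * dv C B) / 4)) = (∑ A, ∑ B, ∑ C, epsUp D A B C *
          (lower v A * (contrFst c v B C - 2 * dv C B))) / 4 := fun D => by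
    simp only [Finset.sum_div]
    refine Finset.sum_congr rfl fun _ _ => Finset.sum_congr rfl fun _ _ =>
      Finset.sum_congr rfl fun _ _ => by ring
  simp only [e4, smul_add, Finset.smul_sum, smul_smul]
  have key : ∀ x y z w u t : Matrix (Fin 4) (Fin 4) ℂ,
      x + y + (z + w) + u + t = (x + z + u) + (y + w + t) := by
    intros; abel
  rw [key]
  simp only [← Finset.sum_add_distrib, ← add_smul]
  refine Fintype.sum_congr _ _ fun C => ?_
  congr 1 <;> congr 1 <;> push_cast <;> field_simp <;> ring

/-! ### The Dirac current and the disformal tetrad -/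

/-- Bilinears in a spinor are quadratic forms over the reals, hence smooth. -/
theorem contDiff_quadratic (N : Matrix (Fin 4) (Fin 4) ℂ) :
    ContDiff ℝ 2 fun w : Fin 4 → ℂ => (star w ⬝ᵥ (N *ᵥ w)).re := by
  simp only [dotProduct, Matrix.mulVec, Pi.star_apply, Complex.star_def]
  have h1 : ∀ i, ContDiff ℝ 2 fun w : Fin 4 → ℂ => w i := fun i => contDiff_apply ℝ ℂ i
  have h2 : ∀ i, ContDiff ℝ 2 fun w : Fin 4 → ℂ => (starRingEnd ℂ) (w i) := fun i =>
    Complex.conjCLE.contDiff.comp (h1 i)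
  exact Complex.reCLM.contDiff.comp (f := fun w : Fin 4 → ℂ =>
    ∑ i, (starRingEnd ℂ) (w i) * ∑ j, N i j * w j)
    (ContDiff.sum fun i _ => (h2 i).mul (ContDiff.sum fun j _ => contDiff_const.mul (h1 j)))

section
variable {M : Type*} [TopologicalSpace M] [ChartedSpace (EuclideanSpace ℝ (Fin 4)) M]
  {U : Set M} {g : MetricField M} {e : FrameField M} {α β : M → ℝ} {Ψ : SpinorField M}

theorem contMDiffOn_current (hΨ : ContMDiffOn (𝓡 4) 𝓘(ℝ, Fin 4 → ℂ) 2 Ψ U) (A : Fin 4) :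
    ContMDiffOn (𝓡 4) 𝓘(ℝ, ℝ) 2 (current Ψ A) U :=
  (contDiff_quadratic (gam 0 * gam A)).contMDiff.comp_contMDiffOn hΨ

theorem contMDiffOn_currentSq (hΨ : ContMDiffOn (𝓡 4) 𝓘(ℝ, Fin 4 → ℂ) 2 Ψ U) :
    ContMDiffOn (𝓡 4) 𝓘(ℝ, ℝ) 2 (currentSq Ψ) U := by
  have h : ContDiff ℝ 2 fun w : Fin 4 → ℂ =>
      ∑ A, eta A * (star w ⬝ᵥ ((gam 0 * gam A) *ᵥ w)).re ^ 2 :=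
    ContDiff.sum fun A _ => contDiff_const.mul ((contDiff_quadratic _).pow 2)
  exact h.contMDiff.comp_contMDiffOn hΨ

theorem contMDiffOn_sqrt {f : M → ℝ} (hf : ContMDiffOn (𝓡 4) 𝓘(ℝ, ℝ) 2 f U)
    (h0 : ∀ x ∈ U, 0 < f x) : ContMDiffOn (𝓡 4) 𝓘(ℝ, ℝ) 2 (fun x => √(f x)) U := fun x hx =>
  ((Real.contDiffAt_sqrt (h0 x hx).ne').contMDiffAt (n := 2)).comp_contMDiffWithinAt x (hf x hx)

theorem contMDiffOn_currentNorm (hΨ : ContMDiffOn (𝓡 4) 𝓘(ℝ, Fin 4 → ℂ) 2 Ψ U)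
    (hJ : ∀ x ∈ U, 0 < currentSq Ψ x) :
    ContMDiffOn (𝓡 4) 𝓘(ℝ, ℝ) 2 (currentNorm Ψ) U :=
  contMDiffOn_sqrt (contMDiffOn_currentSq hΨ) hJ

theorem contMDiffOn_vUp (hΨ : ContMDiffOn (𝓡 4) 𝓘(ℝ, Fin 4 → ℂ) 2 Ψ U)
    (hJ : ∀ x ∈ U, 0 < currentSq Ψ x) (A : Fin 4) :
    ContMDiffOn (𝓡 4) 𝓘(ℝ, ℝ) 2 (vUp Ψ A) U :=
  (contMDiffOn_current hΨ A).div₀ (contMDiffOn_currentNorm hΨ hJ) fun x hx =>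
    (Real.sqrt_pos.2 (hJ x hx)).ne'

theorem contMDiffOn_vLow (hΨ : ContMDiffOn (𝓡 4) 𝓘(ℝ, Fin 4 → ℂ) 2 Ψ U)
    (hJ : ∀ x ∈ U, 0 < currentSq Ψ x) (A : Fin 4) :
    ContMDiffOn (𝓡 4) 𝓘(ℝ, ℝ) 2 (vLow Ψ A) U :=
  contMDiffOn_const.mul (contMDiffOn_vUp hΨ hJ A)

theorem contMDiffOn_coefA (hα : ContMDiffOn (𝓡 4) 𝓘(ℝ, ℝ) 2 α U) (hα0 : ∀ x ∈ U, 0 < α x) :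
    ContMDiffOn (𝓡 4) 𝓘(ℝ, ℝ) 2 (coefA α) U :=
  contMDiffOn_sqrt hα hα0

theorem contMDiffOn_coefB (hα : ContMDiffOn (𝓡 4) 𝓘(ℝ, ℝ) 2 α U)
    (hβ : ContMDiffOn (𝓡 4) 𝓘(ℝ, ℝ) 2 β U) (hα0 : ∀ x ∈ U, 0 < α x)
    (hαβ : ∀ x ∈ U, 0 < α x + β x) : ContMDiffOn (𝓡 4) 𝓘(ℝ, ℝ) 2 (coefB α β) U :=
  (contMDiffOn_sqrt (hα.add hβ) hαβ).sub (contMDiffOn_sqrt hα hα0)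

omit [TopologicalSpace M] [ChartedSpace (EuclideanSpace ℝ (Fin 4)) M] in
theorem coefA_add_coefB (x : M) : coefA α x + coefB α β x = √(α x + β x) := by
  rw [coefA, coefB]; ring

omit [TopologicalSpace M] [ChartedSpace (EuclideanSpace ℝ (Fin 4)) M] in
theorem sum_vUp_mul_vLow {x : M} (hJ : 0 < currentSq Ψ x) :
    ∑ A, vUp Ψ A x * vLow Ψ A x = 1 := by
  have h : currentNorm Ψ x ^ 2 = currentSq Ψ x := Real.sq_sqrt hJ.le
  have h0 : currentNorm Ψ x ≠ 0 := (Real.sqrt_pos.2 hJ).ne'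
  have : ∀ A, vUp Ψ A x * vLow Ψ A x =
      eta A * current Ψ A x ^ 2 / currentNorm Ψ x ^ 2 := fun A => by
    rw [vLow, vUp]; field_simp
  rw [Finset.sum_congr rfl fun A _ => this A, ← Finset.sum_div, h]
  exact div_self hJ.ne'

variable [IsManifold (𝓡 4) ∞ M]

theorem contMDiffOn_vField (he : IsTetrad U g e)
    (hΨ : ContMDiffOn (𝓡 4) 𝓘(ℝ, Fin 4 → ℂ) 2 Ψ U) (hJ : ∀ x ∈ U, 0 < currentSq Ψ x) :
    ContMDiffOn (𝓡 4) (𝓡 4).tangent 2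
      (fun x => (⟨x, vField e Ψ x⟩ : TangentBundle (𝓡 4) M)) U :=
  ContMDiffOn.sum_section fun A _ => (contMDiffOn_vUp hΨ hJ A).smul_section (he.1 A)

theorem metric_frame_vField (he : IsTetrad U g e) {x : M} (hx : x ∈ U) (A : Fin 4) :
    g x (e A x) (vField e Ψ x) = vLow Ψ A x := by
  simp [vField, he.2 x hx, vLow, mul_comm]

theorem metric_vField_frame (he : IsTetrad U g e) {x : M} (hx : x ∈ U) (A : Fin 4) :
    g x (vField e Ψ x) (e A x) = vLow Ψ A x := by
  simp [vField, he.2 x hx, vLow, mul_comm]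

theorem metric_vField_vField (he : IsTetrad U g e) {x : M} (hx : x ∈ U)
    (hJ : 0 < currentSq Ψ x) : g x (vField e Ψ x) (vField e Ψ x) = 1 := by
  nth_rewrite 1 [vField]
  simp [metric_frame_vField he hx, sum_vUp_mul_vLow hJ]

/-- The covector `ĝ(ê_A, ·)` in terms of `g`. It turns both the orthonormality of the disformal
tetrad and its structure coefficients into computations with `g`. -/
theorem disfMetric_disfTetrad_apply (he : IsTetrad U g e) {x : M} (hx : x ∈ U)
    (hα0 : 0 < α x) (hαβ : 0 < α x + β x) (hJ : 0 < currentSq Ψ x) (A : Fin 4)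
    (X : TangentSpace (𝓡 4) x) :
    disfMetric α β g e Ψ x (disfTetrad α β e Ψ A x) X =
      1 / coefA α x * g x (e A x) X + (1 / (coefA α x + coefB α β x) - 1 / coefA α x) *
        vLow Ψ A x * g x (vField e Ψ x) X := by
  have ha : 0 < coefA α x := Real.sqrt_pos.2 hα0
  have hab : coefA α x + coefB α β x = √(α x + β x) := coefA_add_coefB x
  have hab0 : 0 < coefA α x + coefB α β x := hab ▸ Real.sqrt_pos.2 hαβ
  have h1 : α x = coefA α x ^ 2 := (Real.sq_sqrt hα0.le).symm
  have h2 : α x + β x = (coefA α x + coefB α β x) ^ 2 := by rw [hab, Real.sq_sqrt hαβ.le]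
  have h3 : β x = (coefA α x + coefB α β x) ^ 2 - coefA α x ^ 2 := by linarith
  simp only [disfMetric, disfTetrad, LinearMap.sub_apply, LinearMap.smul_apply,
    LinearMap.smulRight_apply, map_add, map_smul, LinearMap.add_apply, smul_eq_mul,
    metric_vField_vField he hx hJ, metric_vField_frame he hx, h2]
  rw [h3, h1]
  generalize coefA α x = a at *
  generalize coefB α β x = b at *
  field_simp
  ring

theorem isTetrad_disfTetrad (he : IsTetrad U g e) (hα : ContMDiffOn (𝓡 4) 𝓘(ℝ, ℝ) 2 α U)
    (hβ : ContMDiffOn (𝓡 4) 𝓘(ℝ, ℝ) 2 β U) (hα0 : ∀ x ∈ U, 0 < α x)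
    (hαβ : ∀ x ∈ U, 0 < α x + β x) (hΨ : ContMDiffOn (𝓡 4) 𝓘(ℝ, Fin 4 → ℂ) 2 Ψ U)
    (hJ : ∀ x ∈ U, 0 < currentSq Ψ x) :
    IsTetrad U (disfMetric α β g e Ψ) (disfTetrad α β e Ψ) := by
  refine ⟨fun A => ?_, fun x hx A B => ?_⟩
  · exact ((contMDiffOn_coefA hα hα0).smul_section (he.1 A)).add_section
      (((contMDiffOn_coefB hα hβ hα0 hαβ).mul (contMDiffOn_vLow hΨ hJ A)).smul_section
        (contMDiffOn_vField he hΨ hJ))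
  · rw [disfMetric_disfTetrad_apply he hx (hα0 x hx) (hαβ x hx) (hJ x hx)]
    have ha : coefA α x ≠ 0 := (Real.sqrt_pos.2 (hα0 x hx)).ne'
    have hab : coefA α x + coefB α β x ≠ 0 := by
      rw [coefA_add_coefB]; exact (Real.sqrt_pos.2 (hαβ x hx)).ne'
    simp only [disfTetrad, map_add, map_smul, smul_eq_mul, he.2 x hx,
      metric_frame_vField he hx, metric_vField_frame he hx, metric_vField_vField he hx (hJ x hx)]
    field_simp
    ring

end

/-! ### Lie brackets of the disformal tetrad -/

section
variable {M : Type*} [TopologicalSpace M] [ChartedSpace (EuclideanSpace ℝ (Fin 4)) M]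

theorem frameDeriv_eq_mvfderiv {F : Type*} [NormedAddCommGroup F] [NormedSpace ℝ F]
    (e : FrameField M) (A : Fin 4) (f : M → F) (x : M) :
    frameDeriv e A f x = mvfderiv (𝓡 4) f x (e A x) := rfl

variable [IsManifold (𝓡 4) ∞ M]
open VectorField in
theorem mlieBracket_smul_add_smul {X Y V : ∀ x : M, TangentSpace (𝓡 4) x} {r s : M → ℝ} {x : M}
    (hY : MDifferentiableAt (𝓡 4) (𝓡 4).tangent (fun y => (⟨y, Y y⟩ : TangentBundle (𝓡 4) M)) x)
    (hV : MDifferentiableAt (𝓡 4) (𝓡 4).tangent (fun y => (⟨y, V y⟩ : TangentBundle (𝓡 4) M)) x)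
    (hr : MDifferentiableAt (𝓡 4) 𝓘(ℝ, ℝ) r x) (hs : MDifferentiableAt (𝓡 4) 𝓘(ℝ, ℝ) s x) :
    mlieBracket (𝓡 4) X (fun y => r y • Y y + s y • V y) x =
      mvfderiv (𝓡 4) r x (X x) • Y x + r x • mlieBracket (𝓡 4) X Y x
      + (mvfderiv (𝓡 4) s x (X x) • V x + s x • mlieBracket (𝓡 4) X V x) := by
  have : IsManifold (𝓡 4) 2 M := inferInstance
  rw [← mlieBracket_smul_right hr hY, ← mlieBracket_smul_right hs hV,
    ← mlieBracket_add_right (hr.smul_section hY) (hs.smul_section hV)]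
  rfl

open VectorField in
/-- The Leibniz rule for two fields that contain multiples of the same field `V`. -/
theorem mlieBracket_smul_add_smul_smul_add_smul {X Y V : ∀ x : M, TangentSpace (𝓡 4) x}
    {p q r s : M → ℝ} {x : M}
    (hX : MDifferentiableAt (𝓡 4) (𝓡 4).tangent (fun y => (⟨y, X y⟩ : TangentBundle (𝓡 4) M)) x)
    (hY : MDifferentiableAt (𝓡 4) (𝓡 4).tangent (fun y => (⟨y, Y y⟩ : TangentBundle (𝓡 4) M)) x)
    (hV : MDifferentiableAt (𝓡 4) (𝓡 4).tangent (fun y => (⟨y, V y⟩ : TangentBundle (𝓡 4) M)) x)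
    (hp : MDifferentiableAt (𝓡 4) 𝓘(ℝ, ℝ) p x) (hq : MDifferentiableAt (𝓡 4) 𝓘(ℝ, ℝ) q x)
    (hr : MDifferentiableAt (𝓡 4) 𝓘(ℝ, ℝ) r x) (hs : MDifferentiableAt (𝓡 4) 𝓘(ℝ, ℝ) s x) :
    mlieBracket (𝓡 4) (fun y => p y • X y + q y • V y) (fun y => r y • Y y + s y • V y) x =
      mvfderiv (𝓡 4) r x (p x • X x + q x • V x) • Y x
      - mvfderiv (𝓡 4) p x (r x • Y x + s x • V x) • X x
      + (mvfderiv (𝓡 4) s x (p x • X x + q x • V x)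
        - mvfderiv (𝓡 4) q x (r x • Y x + s x • V x)) • V x
      + (p x * r x) • mlieBracket (𝓡 4) X Y x
      + (p x * s x) • mlieBracket (𝓡 4) X V x
      - (q x * r x) • mlieBracket (𝓡 4) Y V x := by
  rw [mlieBracket_smul_add_smul hY hV hr hs,
    mlieBracket_swap_apply (W := Y), mlieBracket_swap_apply (W := V),
    mlieBracket_smul_add_smul hX hV hp hq, mlieBracket_smul_add_smul hX hV hp hq,
    mlieBracket_swap_apply (V := Y) (W := X), mlieBracket_swap_apply (V := V) (W := X),
    mlieBracket_self]
  simp only [map_add, map_smul, smul_eq_mul, Pi.zero_apply]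
  module

variable {U : Set M} {g : MetricField M} {e : FrameField M} {α β : M → ℝ} {Ψ : SpinorField M}

open VectorField in
theorem mlieBracket_sum_smul {ι : Type*} (s : Finset ι) {X : ∀ x : M, TangentSpace (𝓡 4) x}
    {Y : ι → ∀ x : M, TangentSpace (𝓡 4) x} {f : ι → M → ℝ} {x : M}
    (hY : ∀ i, MDifferentiableAt (𝓡 4) (𝓡 4).tangent
      (fun y => (⟨y, Y i y⟩ : TangentBundle (𝓡 4) M)) x)
    (hf : ∀ i, MDifferentiableAt (𝓡 4) 𝓘(ℝ, ℝ) (f i) x) :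
    mlieBracket (𝓡 4) X (fun y => ∑ i ∈ s, f i y • Y i y) x =
      ∑ i ∈ s, (mvfderiv (𝓡 4) (f i) x (X x) • Y i x + f i x • mlieBracket (𝓡 4) X (Y i) x) := by
  classical
  have : IsManifold (𝓡 4) 2 M := inferInstance
  induction s using Finset.induction_on with
  | empty =>
    simp only [Finset.sum_empty]
    exact congrFun (mlieBracket_zero_right (W := X)) x
  | insert i s hi h =>
    simp only [Finset.sum_insert hi]
    rw [← h, ← mlieBracket_smul_right (hf i) (hY i)]
    exact mlieBracket_add_right (W := f i • Y i) (W₁ := fun y => ∑ j ∈ s, f j y • Y j y)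
      ((hf i).smul_section (hY i))
      (MDifferentiableAt.sum_section fun j _ => (hf j).smul_section (hY j))

omit [IsManifold (𝓡 4) ∞ M] in
theorem frameDeriv_mul {f h : M → ℝ} {x : M} (hf : MDifferentiableAt (𝓡 4) 𝓘(ℝ, ℝ) f x)
    (hh : MDifferentiableAt (𝓡 4) 𝓘(ℝ, ℝ) h x) (A : Fin 4) :
    frameDeriv e A (fun y => f y * h y) x =
      f x * frameDeriv e A h x + h x * frameDeriv e A f x := by
  simp only [frameDeriv_eq_mvfderiv, mvfderiv_fun_mul hf hh]
  rfl

omit [IsManifold (𝓡 4) ∞ M] in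
theorem frameDeriv_const_mul {f : M → ℝ} {x : M} (hf : MDifferentiableAt (𝓡 4) 𝓘(ℝ, ℝ) f x)
    (k : ℝ) (A : Fin 4) :
    frameDeriv e A (fun y => k * f y) x = k * frameDeriv e A f x := by
  rw [frameDeriv_mul mdifferentiableAt_const hf]
  simp [frameDeriv_eq_mvfderiv, mvfderiv_const]

omit [IsManifold (𝓡 4) ∞ M] in
theorem frameDeriv_comp {F G : Type*} [NormedAddCommGroup F] [NormedSpace ℝ F]
    [NormedAddCommGroup G] [NormedSpace ℝ G] {q : F → G} {f : M → F} {x : M}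
    (hq : DifferentiableAt ℝ q (f x)) (hf : MDifferentiableAt (𝓡 4) 𝓘(ℝ, F) f x) (A : Fin 4) :
    frameDeriv e A (fun y => q (f y)) x = fderiv ℝ q (f x) (frameDeriv e A f x) := by
  simp only [frameDeriv]
  rw [show (fun y => q (f y)) = q ∘ f from rfl, mfderiv_comp x hq.mdifferentiableAt hf,
    mfderiv_eq_fderiv]
  rfl

omit [IsManifold (𝓡 4) ∞ M] in
theorem frameDeriv_vLow (hU : IsOpen U) (hΨ : ContMDiffOn (𝓡 4) 𝓘(ℝ, Fin 4 → ℂ) 2 Ψ U)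
    (hJ : ∀ x ∈ U, 0 < currentSq Ψ x) {x : M} (hx : x ∈ U) (N K : Fin 4) :
    frameDeriv e N (vLow Ψ K) x = eta K * frameDeriv e N (vUp Ψ K) x :=
  frameDeriv_const_mul (((contMDiffOn_vUp hΨ hJ K).contMDiffAt (hU.mem_nhds hx)).mdifferentiableAt
    two_ne_zero) _ _

omit [IsManifold (𝓡 4) ∞ M] in
/-- The derivative of the normalization `V^A V_A = 1`; the two halves of the product rule are
equal. -/
theorem sum_vUp_mul_frameDeriv_vLow (hU : IsOpen U)
    (hΨ : ContMDiffOn (𝓡 4) 𝓘(ℝ, Fin 4 → ℂ) 2 Ψ U)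
    (hJ : ∀ x ∈ U, 0 < currentSq Ψ x) {x : M} (hx : x ∈ U) (N : Fin 4) :
    ∑ A, vUp Ψ A x * frameDeriv e N (vLow Ψ A) x = 0 := by
  have hd : ∀ A, MDifferentiableAt (𝓡 4) 𝓘(ℝ, ℝ) (vUp Ψ A) x := fun A =>
    ((contMDiffOn_vUp hΨ hJ A).contMDiffAt (hU.mem_nhds hx)).mdifferentiableAt two_ne_zero
  have hd' : ∀ A, MDifferentiableAt (𝓡 4) 𝓘(ℝ, ℝ) (vLow Ψ A) x := fun A =>
    ((contMDiffOn_vLow hΨ hJ A).contMDiffAt (hU.mem_nhds hx)).mdifferentiableAt two_ne_zero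
  have h1 : frameDeriv e N (fun y => ∑ A, vUp Ψ A y * vLow Ψ A y) x = 0 := by
    have : (fun y => ∑ A, vUp Ψ A y * vLow Ψ A y) =ᶠ[nhds x] fun _ => 1 := by
      filter_upwards [hU.mem_nhds hx] with y hy using sum_vUp_mul_vLow (hJ y hy)
    rw [frameDeriv, this.mfderiv_eq, mfderiv_const]
    rfl
  simp only [Fin.sum_univ_four] at h1 ⊢
  have hm : ∀ A, MDifferentiableAt (𝓡 4) 𝓘(ℝ, ℝ) (fun y => vUp Ψ A y * vLow Ψ A y) x := fun A =>
    (hd A).mul (hd' A)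
  have hadd : ∀ {f h : M → ℝ}, MDifferentiableAt (𝓡 4) 𝓘(ℝ, ℝ) f x →
      MDifferentiableAt (𝓡 4) 𝓘(ℝ, ℝ) h x → frameDeriv e N (fun y => f y + h y) x =
        frameDeriv e N f x + frameDeriv e N h x := fun hf hh => by
    simp only [frameDeriv_eq_mvfderiv, mvfderiv_fun_add hf hh]; rfl
  have hm₂ : MDifferentiableAt (𝓡 4) 𝓘(ℝ, ℝ)
      (fun y => vUp Ψ 0 y * vLow Ψ 0 y + vUp Ψ 1 y * vLow Ψ 1 y) x := (hm 0).add (hm 1)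
  have hm₃ : MDifferentiableAt (𝓡 4) 𝓘(ℝ, ℝ) (fun y => vUp Ψ 0 y * vLow Ψ 0 y +
      vUp Ψ 1 y * vLow Ψ 1 y + vUp Ψ 2 y * vLow Ψ 2 y) x := hm₂.add (hm 2)
  rw [hadd hm₃ (hm 3), hadd hm₂ (hm 2), hadd (hm 0) (hm 1)] at h1
  simp only [frameDeriv_mul (hd _) (hd' _)] at h1
  have hs : ∀ A, vLow Ψ A x * frameDeriv e N (vUp Ψ A) x =
      vUp Ψ A x * frameDeriv e N (vLow Ψ A) x := fun A => by
    rw [frameDeriv_vLow hU hΨ hJ hx, vLow]; ring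
  simp only [hs] at h1
  linarith

/-- The array of structure coefficients of a tetrad at the point `x`. -/
def structureAt (g : MetricField M) (e : FrameField M) (x : M) (A B C : Fin 4) : ℝ :=
  structureCoeff g e A B C x

omit [IsManifold (𝓡 4) ∞ M] in
theorem structureAt_swap (g : MetricField M) (e : FrameField M) (x : M) (A B C : Fin 4) :
    structureAt g e x A C B = -structureAt g e x A B C := by
  rw [structureAt, structureAt, structureCoeff, structureCoeff,
    VectorField.mlieBracket_swap_apply, map_neg]

/-- The expression `disfCoeff` evaluated on `g`, `e`, `Ψ`, `α`, `β` at a point; `structureAt_disf`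
identifies it with the structure coefficients of the disformal tetrad. -/
def disfStructureAt (α β : M → ℝ) (g : MetricField M) (e : FrameField M) (Ψ : SpinorField M)
    (x : M) : Fin 4 → Fin 4 → Fin 4 → ℝ :=
  disfCoeff (structureAt g e x) (fun A => vUp Ψ A x) (fun N K => frameDeriv e N (vLow Ψ K) x)
    (coefA α x) (coefB α β x) (fun A => frameDeriv e A (coefA α) x)
    (fun A => frameDeriv e A (coefB α β) x)

/-- The component `g(e_A, [e_C, V])`. -/
theorem metric_frame_bracket_vField (hU : IsOpen U) (he : IsTetrad U g e)
    (hΨ : ContMDiffOn (𝓡 4) 𝓘(ℝ, Fin 4 → ℂ) 2 Ψ U) (hJ : ∀ x ∈ U, 0 < currentSq Ψ x)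
    {x : M} (hx : x ∈ U) (A C : Fin 4) :
    g x (e A x) (VectorField.mlieBracket (𝓡 4) (e C) (vField e Ψ) x) =
      frameDeriv e C (vLow Ψ A) x
        + contrMid (structureAt g e x) (fun A => vUp Ψ A x) A C := by
  have hb := mlieBracket_sum_smul Finset.univ (X := e C) (Y := e) (f := vUp Ψ) (x := x)
    (fun i => ((he.1 i).contMDiffAt (hU.mem_nhds hx)).mdifferentiableAt two_ne_zero)
    (fun i => ((contMDiffOn_vUp hΨ hJ i).contMDiffAt (hU.mem_nhds hx)).mdifferentiableAt
      two_ne_zero)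
  have hV : vField e Ψ = fun y => ∑ i, vUp Ψ i y • e i y := rfl
  rw [hV, hb, frameDeriv_vLow hU hΨ hJ hx]
  simp only [map_sum, map_add, map_smul, smul_eq_mul, Finset.sum_add_distrib, he.2 x hx]
  simp [contrMid, contr, structureAt, structureCoeff, frameDeriv_eq_mvfderiv, mul_comm]

theorem structureAt_disf (hU : IsOpen U) (he : IsTetrad U g e)
    (hα : ContMDiffOn (𝓡 4) 𝓘(ℝ, ℝ) 2 α U)
    (hβ : ContMDiffOn (𝓡 4) 𝓘(ℝ, ℝ) 2 β U) (hα0 : ∀ x ∈ U, 0 < α x)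
    (hαβ : ∀ x ∈ U, 0 < α x + β x) (hΨ : ContMDiffOn (𝓡 4) 𝓘(ℝ, Fin 4 → ℂ) 2 Ψ U)
    (hJ : ∀ x ∈ U, 0 < currentSq Ψ x) {x : M} (hx : x ∈ U) :
    structureAt (disfMetric α β g e Ψ) (disfTetrad α β e Ψ) x = disfStructureAt α β g e Ψ x := by
  funext A B C
  have hn := hU.mem_nhds hx
  have hdA := ((contMDiffOn_coefA hα hα0).contMDiffAt hn).mdifferentiableAt two_ne_zero
  have hdB := ((contMDiffOn_coefB hα hβ hα0 hαβ).contMDiffAt hn).mdifferentiableAt two_ne_zero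
  have hdV := fun A => ((contMDiffOn_vLow hΨ hJ A).contMDiffAt hn).mdifferentiableAt two_ne_zero
  have hdE := fun A => ((he.1 A).contMDiffAt hn).mdifferentiableAt two_ne_zero
  have hb := mlieBracket_smul_add_smul_smul_add_smul (hdE C) (hdE B)
    (((contMDiffOn_vField he hΨ hJ).contMDiffAt hn).mdifferentiableAt two_ne_zero)
    hdA (hdB.mul (hdV C)) hdA (hdB.mul (hdV B))
  have hT : ∀ D, disfTetrad α β e Ψ D = fun y => coefA α y • e D y +
    (coefB α β * vLow Ψ D) y • vField e Ψ y := fun D => rfl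
  rw [structureAt, structureCoeff,
    disfMetric_disfTetrad_apply he hx (hα0 x hx) (hαβ x hx) (hJ x hx), hT, hT, hb]
  have hg : ∀ X, g x (vField e Ψ x) X = ∑ E, vUp Ψ E x * g x (e E x) X := fun X => by
    simp [vField]
  have hV : ∀ C, g x (vField e Ψ x) (VectorField.mlieBracket (𝓡 4) (e C) (vField e Ψ) x) =
      contrTwo (structureAt g e x) (fun A => vUp Ψ A x) C := fun C => by
    rw [hg]
    simp only [metric_frame_bracket_vField hU he hΨ hJ hx, mul_add, Finset.sum_add_distrib,
      sum_vUp_mul_frameDeriv_vLow hU hΨ hJ hx, zero_add]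
    rfl
  have hP : g x (vField e Ψ x) (VectorField.mlieBracket (𝓡 4) (e C) (e B) x) =
      contrFst (structureAt g e x) (fun A => vUp Ψ A x) B C := hg _
  have hS : g x (e A x) (VectorField.mlieBracket (𝓡 4) (e C) (e B) x) =
    structureAt g e x A B C := rfl
  have hlift : ∀ (D : Fin 4) (f : M → ℝ), mvfderiv (𝓡 4) f x (coefA α x • e D x +
      (coefB α β * vLow Ψ D) x • vField e Ψ x) =
        liftDeriv (fun A => vUp Ψ A x) (coefA α x) (coefB α β x) D
          (fun F => frameDeriv e F f x) := fun D f => by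
    rw [vField, map_add, map_smul, map_smul, map_sum]
    simp [liftDeriv, contr, lower, vLow, frameDeriv_eq_mvfderiv]
  have hdf : ∀ D F, frameDeriv e F (coefB α β * vLow Ψ D) x =
      frameDeriv e F (coefB α β) x * lower (fun A => vUp Ψ A x) D +
        coefB α β x * frameDeriv e F (vLow Ψ D) x := fun D F => by
    have := frameDeriv_mul (e := e) hdB (hdV D) F
    rw [show (fun y => coefB α β y * vLow Ψ D y) = coefB α β * vLow Ψ D from rfl] at this
    rw [this, show lower (fun A => vUp Ψ A x) D = vLow Ψ D x from rfl]
    ring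
  simp only [hlift, hdf]
  simp only [map_add, map_sub, map_smul, smul_eq_mul, he.2 x hx, metric_frame_vField he hx,
    metric_vField_frame he hx, metric_vField_vField he hx (hJ x hx), hP, hS, hV,
    metric_frame_bracket_vField hU he hΨ hJ hx, Pi.mul_apply]
  simp only [disfStructureAt, disfCoeff, show ∀ D, lower (fun A => vUp Ψ A x) D = vLow Ψ D x from
    fun _ => rfl]
  ring

end

/-! ### Acceleration, expansion and vorticity -/

section
variable {M : Type*} [TopologicalSpace M] [ChartedSpace (EuclideanSpace ℝ (Fin 4)) M]
  {U : Set M} {g : MetricField M} {e : FrameField M} {α β : M → ℝ} {Ψ : SpinorField M}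

theorem nablaV_eq (N K : Fin 4) (x : M) :
    nablaV g e Ψ N K x = frameDeriv e N (vLow Ψ K) x +
      (contrMid (structureAt g e x) (fun A => vUp Ψ A x) K N
        + contrMid (structureAt g e x) (fun A => vUp Ψ A x) N K
        - contrFst (structureAt g e x) (fun A => vUp Ψ A x) K N) / 2 := by
  rw [nablaV]
  congr 1
  simp only [contrMid, contrFst, contr, ← Finset.sum_add_distrib, ← Finset.sum_sub_distrib,
    Finset.sum_div]
  refine Finset.sum_congr rfl fun L _ => ?_
  rw [structureAt_swap g e x N K L]
  simp only [spinCoeff, structureAt]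
  ring

theorem acceleration_eq (A : Fin 4) (x : M) :
    acceleration g e Ψ A x = contr (fun A => vUp Ψ A x) (fun N => frameDeriv e N (vLow Ψ A) x) +
      contrTwo (structureAt g e x) (fun A => vUp Ψ A x) A := by
  have hQ := contr_contrMid (structureAt_swap g e x) (fun A => vUp Ψ A x) A
  have hP := contr_contrFst (structureAt_swap g e x) (fun A => vUp Ψ A x) A
  have hR : ∑ N, vUp Ψ N x * contrMid (structureAt g e x) (fun A => vUp Ψ A x) N A =
    contrTwo (structureAt g e x) (fun A => vUp Ψ A x) A := rfl
  simp only [acceleration, nablaV_eq, mul_add, mul_sub, mul_div_assoc', Finset.sum_add_distrib,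
    Finset.sum_sub_distrib, ← Finset.sum_div, hQ, hP, hR, contr]
  ring

theorem sum_eta_nablaV (x : M) :
    ∑ A, eta A * nablaV g e Ψ A A x = ∑ A, eta A * (frameDeriv e A (vLow Ψ A) x +
      contrMid (structureAt g e x) (fun A => vUp Ψ A x) A A) := by
  refine Finset.sum_congr rfl fun A _ => ?_
  have : contrFst (structureAt g e x) (fun A => vUp Ψ A x) A A = 0 := by
    linarith [contrFst_swap (structureAt_swap g e x) (fun A => vUp Ψ A x) A A]
  rw [nablaV_eq, this]
  ring

/-- The projectors in the vorticity tensor only add multiples of `V_B` and of `V_C`, which the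
contraction with `ε^{ABCD} V_D` in the vorticity vector kills. -/
theorem vorticityTensor_eq (x : M) : ∃ u w : Fin 4 → ℝ, ∀ B C,
    vorticityTensor g e Ψ B C x = (nablaV g e Ψ C B x - nablaV g e Ψ B C x) / 2 +
      vLow Ψ B x * u C + vLow Ψ C x * w B := by
  set X : Fin 4 → Fin 4 → ℝ := fun K N => nablaV g e Ψ N K x - nablaV g e Ψ K N x with hX
  refine ⟨fun C => -(∑ K, vUp Ψ K x * X K C) / 2 +
      vLow Ψ C x * (∑ K, ∑ N, vUp Ψ K x * vUp Ψ N x * X K N) / 2,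
    fun B => -(∑ N, vUp Ψ N x * X B N) / 2, fun B C => ?_⟩
  have h : ∀ K N, proj Ψ B K x * proj Ψ C N x * X K N =
      (if B = K then (if C = N then X K N else 0) else 0)
      - vLow Ψ B x * (if C = N then vUp Ψ K x * X K N else 0)
      - vLow Ψ C x * (if B = K then vUp Ψ N x * X K N else 0)
      + vLow Ψ B x * vLow Ψ C x * (vUp Ψ K x * vUp Ψ N x * X K N) := fun K N => by
    rw [proj, proj]; split_ifs <;> ring
  have hv : vorticityTensor g e Ψ B C x =
    (∑ K, ∑ N, proj Ψ B K x * proj Ψ C N x * X K N) / 2 := rfl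
  rw [hv]
  simp only [h, Finset.sum_add_distrib, Finset.sum_sub_distrib, ← Finset.mul_sum]
  have h1 : ∑ K, ∑ N, (if B = K then (if C = N then X K N else 0) else 0) = X B C := by simp
  have h2 : ∑ K, ∑ N, (if C = N then vUp Ψ K x * X K N else 0) = ∑ K, vUp Ψ K x * X K C := by simp
  have h3 : ∑ K, ∑ N, (if B = K then vUp Ψ N x * X K N else 0) = ∑ N, vUp Ψ N x * X B N := by
    rw [Finset.sum_comm]; simp
  rw [h1, h2, h3]
  ring

/-- The vorticity vector as the totally antisymmetric expression that occurs in
`sum_epsUp_disfCoeff`. -/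
theorem vorticity_eq (D : Fin 4) (x : M) :
    vorticity g e Ψ D x = ∑ A, ∑ B, ∑ C, epsUp D A B C * (lower (fun A => vUp Ψ A x) A *
      ((contrFst (structureAt g e x) (fun A => vUp Ψ A x) B C -
        2 * frameDeriv e C (vLow Ψ B) x) / 4)) := by
  obtain ⟨u, w, h⟩ := vorticityTensor_eq (g := g) (e := e) (Ψ := Ψ) x
  have hs := contrFst_swap (structureAt_swap g e x) (fun A => vUp Ψ A x)
  have hl : ∀ D, lower (fun A => vUp Ψ A x) D = vLow Ψ D x := fun _ => rfl
  simp only [vorticity, h, nablaV_eq, hl, mul_assoc]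
  fin_cases D <;> simp only [Fin.zero_eta, Fin.mk_one, Fin.reduceFinMk, sum_epsUp_zero,
    sum_epsUp_one, sum_epsUp_two, sum_epsUp_three]
  · rw [hs 1 2, hs 1 3, hs 2 3]; ring
  · rw [hs 0 2, hs 0 3, hs 2 3]; ring
  · rw [hs 0 1, hs 0 3, hs 1 3]; ring
  · rw [hs 0 1, hs 0 2, hs 1 2]; ring

end

/-! ### Conservation of the Dirac current -/

section
variable {M : Type*} [TopologicalSpace M] [ChartedSpace (EuclideanSpace ℝ (Fin 4)) M]
  {U : Set M} {g : MetricField M} {e : FrameField M} {α β : M → ℝ} {Ψ : SpinorField M}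

/-- The derivative of a component of the current with respect to the spinor; the form is
Hermitian, so the two halves of the product rule have the same real part. -/
theorem fderiv_quadratic (A : Fin 4) (w z : Fin 4 → ℂ) :
    fderiv ℝ (fun w : Fin 4 → ℂ => (star w ⬝ᵥ ((gam 0 * gam A) *ᵥ w)).re) w z =
      2 * (star w ⬝ᵥ ((gam 0 * gam A) *ᵥ z)).re := by
  have hd : DifferentiableAt ℝ (fun w : Fin 4 → ℂ => (star w ⬝ᵥ ((gam 0 * gam A) *ᵥ w)).re) w :=
    (contDiff_quadratic _).differentiable two_ne_zero _
  -- along a line the form is a polynomial in `t`; the derivative is its linear coefficient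
  rw [← hd.lineDeriv_eq_fderiv, lineDeriv]
  have h : (fun t : ℝ => (star (w + t • z) ⬝ᵥ ((gam 0 * gam A) *ᵥ (w + t • z))).re) = fun t =>
      (star w ⬝ᵥ ((gam 0 * gam A) *ᵥ w)).re + t * (2 * (star w ⬝ᵥ ((gam 0 * gam A) *ᵥ z)).re)
        + t ^ 2 * (star z ⬝ᵥ ((gam 0 * gam A) *ᵥ z)).re := by
    funext t
    have hc : (star z ⬝ᵥ ((gam 0 * gam A) *ᵥ w)).re = (star w ⬝ᵥ ((gam 0 * gam A) *ᵥ z)).re := by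
      rw [← current_sesquilinear A w z]; simp
    simp only [star_add, star_smul, star_trivial, add_dotProduct, Matrix.mulVec_add,
      Matrix.mulVec_smul, dotProduct_add, smul_dotProduct, dotProduct_smul, Complex.add_re,
      Complex.smul_re, smul_eq_mul, hc]
    ring
  rw [h]
  have h1 : HasDerivAt (fun t : ℝ =>
      (star w ⬝ᵥ ((gam 0 * gam A) *ᵥ w)).re + t * (2 * (star w ⬝ᵥ ((gam 0 * gam A) *ᵥ z)).re)
        + t ^ 2 * (star z ⬝ᵥ ((gam 0 * gam A) *ᵥ z)).re)
      (2 * (star w ⬝ᵥ ((gam 0 * gam A) *ᵥ z)).re) 0 := by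
    have := (((hasDerivAt_id (0 : ℝ)).mul_const
      (2 * (star w ⬝ᵥ ((gam 0 * gam A) *ᵥ z)).re)).const_add
        ((star w ⬝ᵥ ((gam 0 * gam A) *ᵥ w)).re)).add
      (((hasDerivAt_id (0 : ℝ)).pow 2).mul_const (star z ⬝ᵥ ((gam 0 * gam A) *ᵥ z)).re)
    simpa using! this
  exact h1.deriv

theorem frameDeriv_current (hU : IsOpen U) (hΨ : ContMDiffOn (𝓡 4) 𝓘(ℝ, Fin 4 → ℂ) 2 Ψ U)
    {x : M} (hx : x ∈ U) (A B : Fin 4) :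
    frameDeriv e A (current Ψ B) x =
      2 * (star (Ψ x) ⬝ᵥ ((gam 0 * gam B) *ᵥ frameDeriv e A Ψ x)).re := by
  have h := frameDeriv_comp (e := e)
    ((contDiff_quadratic (gam 0 * gam B)).differentiable two_ne_zero (Ψ x))
    ((hΨ.contMDiffAt (hU.mem_nhds hx)).mdifferentiableAt two_ne_zero) A
  rw [fderiv_quadratic] at h
  exact h

theorem fockIvanenko_eq (A : Fin 4) (x : M) :
    fockIvanenko g e A x = connMat (structureAt g e x) A := rfl

theorem diracOp_eq (x : M) : diracOp g e Ψ x = ∑ A, gam A *ᵥ frameDeriv e A Ψ x +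
    (-∑ A, gam A * connMat (structureAt g e x) A) *ᵥ Ψ x := by
  simp only [diracOp, covDeriv, Matrix.mulVec_sub, Finset.sum_sub_distrib, Matrix.neg_mulVec,
    Matrix.sum_mulVec, ← Matrix.mulVec_mulVec, fockIvanenko_eq]
  abel

/-- Conservation of the Dirac current, `∇_A J^A = 0`, for a solution of the Dirac equation with
real mass. It is the real part of `Ψ̄ (DΨ + imΨ) = 0`. -/
theorem current_divergence (hU : IsOpen U) (hΨ : ContMDiffOn (𝓡 4) 𝓘(ℝ, Fin 4 → ℂ) 2 Ψ U)
    {x : M} (hx : x ∈ U) {m : ℝ} (hD : diracOp g e Ψ x = -(Complex.I * m) • Ψ x) :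
    ∑ A, frameDeriv e A (current Ψ A) x +
      ∑ C, (∑ A, eta A * structureAt g e x A C A) * current Ψ C x = 0 := by
  -- the mass term `-im Ψ̄Ψ` is imaginary and disappears in the real part
  have h := congrArg (fun z => (star (Ψ x) ⬝ᵥ (gam 0 *ᵥ z)).re) hD
  rw [diracOp_eq, neg_sum_gam_mul_connMat (structureAt_swap g e x)] at h
  simp only [Matrix.mulVec_add, Matrix.add_mulVec, Matrix.mulVec_sum, Matrix.sum_mulVec,
    Matrix.smul_mulVec, Matrix.mulVec_smul, Matrix.mulVec_mulVec, dotProduct_add, dotProduct_sum,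
    dotProduct_smul] at h
  simp only [smul_eq_mul, Complex.add_re, Complex.re_sum, Complex.mul_re, Complex.im_sum,
    Complex.mul_im, axial_real, scalar_real, Complex.ofReal_re, Complex.ofReal_im] at h
  simp [frameDeriv_current hU hΨ hx, current] at h ⊢
  rw [← Finset.mul_sum]
  linarith

/-- Current conservation for `J = √J² V`: the expansion of `V` is `-(ln √J²)^•`. -/
theorem sum_eta_nablaV_eq (hU : IsOpen U) (hΨ : ContMDiffOn (𝓡 4) 𝓘(ℝ, Fin 4 → ℂ) 2 Ψ U)
    (hJ : ∀ x ∈ U, 0 < currentSq Ψ x)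
    {x : M} (hx : x ∈ U) {m : ℝ} (hD : diracOp g e Ψ x = -(Complex.I * m) • Ψ x) :
    ∑ A, eta A * nablaV g e Ψ A A x =
      -dotDeriv e Ψ (fun y => Real.log (currentNorm Ψ y)) x := by
  have hn := hU.mem_nhds hx
  have hj : currentNorm Ψ x ≠ 0 := (Real.sqrt_pos.2 (hJ x hx)).ne'
  have hdj := ((contMDiffOn_currentNorm hΨ hJ).contMDiffAt hn).mdifferentiableAt two_ne_zero
  have hdv := fun A => ((contMDiffOn_vUp hΨ hJ A).contMDiffAt hn).mdifferentiableAt two_ne_zero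
  have h1 : ∀ A, frameDeriv e A (current Ψ A) x = currentNorm Ψ x * frameDeriv e A (vUp Ψ A) x +
      vUp Ψ A x * frameDeriv e A (currentNorm Ψ) x := fun A => by
    have h : current Ψ A =ᶠ[nhds x] fun y => currentNorm Ψ y * vUp Ψ A y := by
      filter_upwards [hn] with y hy
      have : currentNorm Ψ y ≠ 0 := (Real.sqrt_pos.2 (hJ y hy)).ne'
      rw [vUp]; field_simp
    rw [← frameDeriv_mul hdj (hdv A), frameDeriv, h.mfderiv_eq]
    rfl
  have h2 : ∀ A, frameDeriv e A (fun y => Real.log (currentNorm Ψ y)) x =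
      frameDeriv e A (currentNorm Ψ) x / currentNorm Ψ x := fun A => by
    rw [frameDeriv_comp (Real.differentiableAt_log hj) hdj, fderiv_eq_smul_deriv, Real.deriv_log]
    rfl
  have h3 : ∀ A, current Ψ A x = currentNorm Ψ x * vUp Ψ A x := fun A => by
    rw [vUp]; field_simp
  have hd := current_divergence hU hΨ hx hD
  have h4 : ∀ A, eta A * (frameDeriv e A (vLow Ψ A) x +
      contrMid (structureAt g e x) (fun A => vUp Ψ A x) A A) = frameDeriv e A (vUp Ψ A) x +
      eta A * contrMid (structureAt g e x) (fun A => vUp Ψ A x) A A := fun A => by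
    rw [frameDeriv_vLow hU hΨ hJ hx]
    linear_combination frameDeriv e A (vUp Ψ A) x * eta_mul_self A
  rw [sum_eta_nablaV, Finset.sum_congr rfl fun A _ => h4 A, Finset.sum_add_distrib, contr_trace,
    dotDeriv]
  simp only [h2, mul_div_assoc', ← Finset.sum_div]
  simp only [h1, h3, Finset.sum_add_distrib, ← Finset.mul_sum] at hd
  have h5 : ∑ C, (∑ A, eta A * structureAt g e x A C A) * (currentNorm Ψ x * vUp Ψ C x) =
      currentNorm Ψ x * ∑ C, vUp Ψ C x * ∑ A, eta A * structureAt g e x A C A := by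
    rw [Finset.mul_sum]; exact Finset.sum_congr rfl fun _ _ => by ring
  rw [h5] at hd
  field_simp
  linear_combination hd

end

/-! ### Spinors obeying the Inomata condition -/

section
variable {M : Type*} [TopologicalSpace M] [ChartedSpace (EuclideanSpace ℝ (Fin 4)) M]
  {U : Set M} {g : MetricField M} {e : FrameField M} {α β : M → ℝ} {Ψ : SpinorField M}

/-- The matrix `v̸ = γ^A V_A`. -/
def slashV (Ψ : SpinorField M) (x : M) : Matrix (Fin 4) (Fin 4) ℂ :=
  ∑ A, (vLow Ψ A x : ℂ) • gam A

omit [TopologicalSpace M] [ChartedSpace (EuclideanSpace ℝ (Fin 4)) M] in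
theorem sum_vUp_gamLow (x : M) : ∑ A, (vUp Ψ A x : ℂ) • gamLow A = slashV Ψ x := by
  refine Finset.sum_congr rfl fun A _ => ?_
  rw [gamLow, smul_smul, vLow]
  push_cast
  rw [mul_comm]

omit [TopologicalSpace M] [ChartedSpace (EuclideanSpace ℝ (Fin 4)) M] in
theorem slashV_mul_self {x : M} (hJ : 0 < currentSq Ψ x) : slashV Ψ x * slashV Ψ x = 1 :=
  sum_lower_gam_mul_self (v := fun A => vUp Ψ A x) (sum_vUp_mul_vLow hJ)

omit [TopologicalSpace M] [ChartedSpace (EuclideanSpace ℝ (Fin 4)) M] in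
theorem slashV_mul_cliff (x : M) (c d : ℂ) :
    slashV Ψ x * cliff c d = cliff c (-d) * slashV Ψ x := by
  simp only [slashV, Matrix.sum_mul, Matrix.mul_sum, Matrix.smul_mul, Matrix.mul_smul,
    gam_mul_cliff]

omit [TopologicalSpace M] [ChartedSpace (EuclideanSpace ℝ (Fin 4)) M] in
/-- The Fierz identity `current_slash_mulVec`, normalized. -/
theorem slashV_mulVec (x : M) : slashV Ψ x *ᵥ Ψ x =
    (1 / (currentNorm Ψ x : ℂ)) • (cliff (scalA Ψ x) (Complex.I * scalB Ψ x) *ᵥ Ψ x) := by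
  rw [← current_slash_mulVec, ← sum_vUp_gamLow, ← Matrix.smul_mulVec, Finset.smul_sum]
  congr 1
  refine Finset.sum_congr rfl fun A _ => ?_
  rw [smul_smul, vUp]
  push_cast
  congr 1
  ring

theorem sum_vorticityLow_gam (x : M) :
    ∑ A, (vorticityLow g e Ψ A x : ℂ) • gam A = vorticitySlash g e Ψ x := by
  refine Finset.sum_congr rfl fun A _ => ?_
  rw [gamLow, smul_smul, vorticityLow]
  push_cast
  rw [mul_comm]

/-- The vorticity vector is orthogonal to `V`. -/
theorem sum_vUp_mul_vorticityLow (x : M) : ∑ A, vUp Ψ A x * vorticityLow g e Ψ A x = 0 := by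
  have h : ∀ A, vUp Ψ A x * vorticityLow g e Ψ A x = vLow Ψ A x * vorticity g e Ψ A x := fun A => by
    rw [vLow, vorticityLow]; ring
  have hl : ∀ D, lower (fun A => vUp Ψ A x) D = vLow Ψ D x := fun _ => rfl
  simp only [h, vorticity_eq, hl, Fin.sum_univ_four (f := fun A => vLow Ψ A x * _),
    sum_epsUp_zero, sum_epsUp_one, sum_epsUp_two, sum_epsUp_three]
  ring

/-- A spinor of the class solves the Dirac equation of `g`. The four terms of the condition are
contracted with `γ^A` in the steps `e1` to `e4`; the last two cancel. -/
theorem diracOp_of_inomata {m : ℝ} {s₀ s₁ s₂ : M → ℂ}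
    (h : InomataCondition U g e m s₀ s₁ s₂ (fun x => -4 * s₁ x) (fun x => -4 * s₂ x) Ψ)
    {x : M} (hx : x ∈ U) (hJ : 0 < currentSq Ψ x) :
    diracOp g e Ψ x = -(Complex.I * m) • Ψ x := by
  have hj : (currentNorm Ψ x : ℂ) ≠ 0 := by exact_mod_cast (Real.sqrt_pos.2 hJ).ne'
  have hj2 : (currentNorm Ψ x : ℂ) ^ 2 = (scalA Ψ x : ℂ) ^ 2 + (scalB Ψ x : ℂ) ^ 2 := by
    exact_mod_cast currentNorm_sq x
  have hB := h x hx
  simp only at hB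
  simp only [diracOp, hB, ← Matrix.smul_mulVec, ← Matrix.add_mulVec, ← Matrix.sub_mulVec,
    Matrix.mulVec_mulVec, ← Matrix.sum_mulVec]
  have e1 : ∀ c d, ∑ A, gam A * ((vLow Ψ A x : ℂ) • cliff c d) = cliff c (-d) * slashV Ψ x :=
    fun c d => by
      rw [← slashV_mul_cliff, slashV, Matrix.sum_mul]
      simp only [Matrix.smul_mul, Matrix.mul_smul]
  have e2 : ∀ k a b c d, ∑ A, gam A * ((k : ℂ) • (cliff a b * cliff c d * gamLow A)) =
      (4 * k) • (cliff a (-b) * cliff c (-d)) := fun k a b c d => by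
    have : ∀ A, gam A * (k • (cliff a b * cliff c d * gamLow A)) =
        k • (cliff a (-b) * cliff c (-d) * (gam A * gamLow A)) := fun A => by
      rw [Matrix.mul_smul, ← mul_assoc, ← mul_assoc, gam_mul_cliff, mul_assoc (cliff a (-b)),
        gam_mul_cliff]
      simp only [mul_assoc]
    simp only [this, ← Finset.smul_sum, ← Finset.mul_sum, sum_gam_mul_gamLow, Matrix.mul_smul,
      mul_one, smul_smul, mul_comm]
  have e3 : ∀ N, ∑ A, gam A * (gamLow A * vorticitySlash g e Ψ x * N) =
      (4 : ℂ) • (vorticitySlash g e Ψ x * N) := fun N => by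
    simp only [mul_assoc, ← mul_assoc (gam _), gam_mul_gamLow, one_mul, Fin.sum_univ_four]
    module
  have e4 : ∀ N, ∑ A, gam A * ((vorticityLow g e Ψ A x : ℂ) • N) =
      vorticitySlash g e Ψ x * N := fun N => by
    rw [← sum_vorticityLow_gam, Matrix.sum_mul]
    simp only [Matrix.smul_mul, Matrix.mul_smul]
  have e5 : cliff (-4 * s₁ x) (-4 * s₂ x) = (-4 : ℂ) • cliff (s₁ x) (s₂ x) := by
    simp only [cliff]; module
  simp only [mul_add, mul_sub, Finset.sum_add_distrib, Finset.sum_sub_distrib, e1, e2, e3, e4, e5]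
  -- `s₃ = -4 s₁` and `s₄ = -4 s₂` cancel the vorticity terms against `γ^A γ_A = 4`
  rw [Matrix.mul_smul, neg_smul, add_neg_cancel_right, Matrix.sub_mulVec,
    ← Matrix.mulVec_mulVec, slashV_mulVec]
  have hΨ : ∀ k : ℂ, k • Ψ x = cliff k 0 *ᵥ Ψ x := fun k => by
    rw [cliff_zero, Matrix.smul_mulVec, Matrix.one_mulVec]
  rw [hΨ, ← Matrix.smul_mulVec, Matrix.mulVec_mulVec, ← Matrix.sub_mulVec, Matrix.mul_smul]
  simp only [cliff_mul_cliff, smul_cliff, cliff_sub_cliff]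
  generalize (currentNorm Ψ x : ℂ) = j at *
  congr 2
  · field_simp
    rw [hj2]
    ring
  · field_simp
    linear_combination (-3 * scalB Ψ x * m * scalA Ψ x : ℂ) * Complex.I_sq

/-- The derivative `∇_V Ψ`; the last term of the condition drops out since the vorticity is
orthogonal to `V`. -/
theorem sum_vUp_covDeriv_of_inomata {m : ℝ} {s₀ s₁ s₂ s₃ s₄ : M → ℂ}
    (h : InomataCondition U g e m s₀ s₁ s₂ s₃ s₄ Ψ)
    {x : M} (hx : x ∈ U) (hJ : 0 < currentSq Ψ x) :
    ∑ B, (vUp Ψ B x : ℂ) • covDeriv g e B Ψ x =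
      (3 / 4 * s₀ x - Complex.I * m * scalA Ψ x / (4 * currentNorm Ψ x)) • Ψ x +
        (slashV Ψ x * vorticitySlash g e Ψ x * cliff (s₁ x) (s₂ x)) *ᵥ Ψ x := by
  have hj : (currentNorm Ψ x : ℂ) ≠ 0 := by exact_mod_cast (Real.sqrt_pos.2 hJ).ne'
  have hj2 : (currentNorm Ψ x : ℂ) ^ 2 = (scalA Ψ x : ℂ) ^ 2 + (scalB Ψ x : ℂ) ^ 2 := by
    exact_mod_cast currentNorm_sq x
  have hB := h x hx
  simp only at hB
  simp only [hB, ← Matrix.smul_mulVec, ← Matrix.add_mulVec, ← Matrix.sub_mulVec,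
    ← Matrix.sum_mulVec]
  have e1 : ∀ N : Matrix (Fin 4) (Fin 4) ℂ,
      ∑ A, (vUp Ψ A x : ℂ) • ((vLow Ψ A x : ℂ) • N) = N := fun N => by
    simp only [smul_smul, ← Finset.sum_smul]
    have : ∑ A, (vUp Ψ A x : ℂ) * vLow Ψ A x = 1 := by exact_mod_cast sum_vUp_mul_vLow hJ
    rw [this, one_smul]
  have e2 : ∀ (k : ℂ) N, ∑ A, (vUp Ψ A x : ℂ) • (k • (N * gamLow A)) = k • (N * slashV Ψ x) :=
    fun k N => by
      rw [← sum_vUp_gamLow, Finset.mul_sum, Finset.smul_sum]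
      refine Fintype.sum_congr _ _ fun A => ?_
      rw [Matrix.mul_smul, smul_comm]
  have e3 : ∀ N N', ∑ A, (vUp Ψ A x : ℂ) • (gamLow A * N * N') = slashV Ψ x * N * N' :=
    fun N N' => by
      rw [← sum_vUp_gamLow, Finset.sum_mul, Finset.sum_mul]
      simp only [Matrix.smul_mul]
  have e4 : ∀ N : Matrix (Fin 4) (Fin 4) ℂ,
      ∑ A, (vUp Ψ A x : ℂ) • ((vorticityLow g e Ψ A x : ℂ) • N) = 0 := fun N => by
    simp only [smul_smul, ← Finset.sum_smul]
    have : ∑ A, (vUp Ψ A x : ℂ) * vorticityLow g e Ψ A x = 0 := by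
      exact_mod_cast sum_vUp_mul_vorticityLow x
    rw [this, zero_smul]
  simp only [smul_add, smul_sub, Finset.sum_add_distrib, Finset.sum_sub_distrib, e1, e2, e3, e4]
  have hΨ : ∀ k : ℂ, k • Ψ x = cliff k 0 *ᵥ Ψ x := fun k => by
    rw [cliff_zero, Matrix.smul_mulVec, Matrix.one_mulVec]
  rw [add_zero, Matrix.add_mulVec, Matrix.sub_mulVec, Matrix.smul_mulVec,
    ← Matrix.mulVec_mulVec (Ψ x) _ (slashV Ψ x),
    slashV_mulVec, Matrix.mulVec_smul, Matrix.mulVec_mulVec, smul_smul, hΨ, ← Matrix.smul_mulVec,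
    ← Matrix.sub_mulVec]
  congr 2
  simp only [cliff_mul_cliff, smul_cliff, cliff_sub_cliff]
  generalize (currentNorm Ψ x : ℂ) = j at *
  congr 1
  · field_simp
    rw [hj2]
    linear_combination 12 * s₀ x * j * hj2 + (3 * s₀ x * j * scalB Ψ x ^ 2 +
      3 * scalA Ψ x * Complex.I * m * scalB Ψ x ^ 2) * Complex.I_sq
  · field_simp
    rw [hj2]
    linear_combination (-4 * scalB Ψ x ^ 3 * m : ℂ) * Complex.I_sq

end

/-! ### The Dirac operator of the disformal metric -/

section
variable {M : Type*} [TopologicalSpace M] [ChartedSpace (EuclideanSpace ℝ (Fin 4)) M]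
  {U : Set M} {g : MetricField M} {e : FrameField M} {α β : M → ℝ} {Ψ : SpinorField M}

theorem frameDeriv_disfTetrad (A : Fin 4) (x : M) :
    frameDeriv (disfTetrad α β e Ψ) A Ψ x = coefA α x • frameDeriv e A Ψ x +
      (coefB α β x * vLow Ψ A x) • ∑ B, vUp Ψ B x • frameDeriv e B Ψ x := by
  simp only [frameDeriv_eq_mvfderiv, disfTetrad, vField, map_add, map_smul, map_sum]

/-- The coefficients `y_C` of the term `½ y_C γ^C Ψ` in the Dirac operator of the disformal
metric, built from the acceleration, the expansion and the gradients of `a` and `b`. The two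
subtracted terms are `3 ê_C(a) / a` and `ê_C(a + b) / (a + b)`. -/
def diracShift (α β : M → ℝ) (g : MetricField M) (e : FrameField M) (Ψ : SpinorField M) (x : M)
    (C : Fin 4) : ℝ :=
  coefB α β x * acceleration g e Ψ C x
    + coefB α β x * (∑ A, eta A * nablaV g e Ψ A A x) * vLow Ψ C x
    + frameDeriv e C (coefA α) x + dotDeriv e Ψ (coefB α β) x * vLow Ψ C x
    - 3 * (coefA α x * frameDeriv e C (coefA α) x +
        coefB α β x * vLow Ψ C x * dotDeriv e Ψ (coefA α) x) / coefA α x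
    - (coefA α x * (frameDeriv e C (coefA α) x + frameDeriv e C (coefB α β) x) +
        coefB α β x * vLow Ψ C x * (dotDeriv e Ψ (coefA α) x + dotDeriv e Ψ (coefB α β) x)) /
      (coefA α x + coefB α β x)

/-- The Dirac operator of the disformal metric in terms of that of `g`. -/
theorem diracOp_disf [IsManifold (𝓡 4) ∞ M] (hU : IsOpen U) (he : IsTetrad U g e)
    (hα : ContMDiffOn (𝓡 4) 𝓘(ℝ, ℝ) 2 α U)
    (hβ : ContMDiffOn (𝓡 4) 𝓘(ℝ, ℝ) 2 β U) (hα0 : ∀ x ∈ U, 0 < α x)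
    (hαβ : ∀ x ∈ U, 0 < α x + β x) (hΨ : ContMDiffOn (𝓡 4) 𝓘(ℝ, Fin 4 → ℂ) 2 Ψ U)
    (hJ : ∀ x ∈ U, 0 < currentSq Ψ x) {x : M} (hx : x ∈ U) :
    diracOp (disfMetric α β g e Ψ) (disfTetrad α β e Ψ) Ψ x =
      (coefA α x : ℂ) • diracOp g e Ψ x
      + (coefB α β x : ℂ) • (slashV Ψ x *ᵥ ∑ B, (vUp Ψ B x : ℂ) • covDeriv g e B Ψ x)
      + ((1 / 2 : ℂ) • ∑ C, (diracShift α β g e Ψ x C : ℂ) • gam C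
        + (Complex.I * coefB α β x ^ 2 / (2 * (coefA α x + coefB α β x))) •
          (vorticitySlash g e Ψ x * gam5)) *ᵥ Ψ x := by
  have ha : coefA α x ≠ 0 := (Real.sqrt_pos.2 (hα0 x hx)).ne'
  have hab : coefA α x + coefB α β x ≠ 0 := by
    rw [coefA_add_coefB]; exact (Real.sqrt_pos.2 (hαβ x hx)).ne'
  have hM := connMat_disfCoeff (structureAt_swap g e x) (v := fun A => vUp Ψ A x)
    (sum_vUp_mul_vLow (hJ x hx)) (dv := fun N K => frameDeriv e N (vLow Ψ K) x)
    (sum_vUp_mul_frameDeriv_vLow hU hΨ hJ hx) (fun A => frameDeriv e A (coefA α) x)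
    (fun A => frameDeriv e A (coefB α β) x) ha hab
  have hshift : ∀ C, diracShift α β g e Ψ x C = coefB α β x *
      (contr (fun A => vUp Ψ A x) (fun N => frameDeriv e N (vLow Ψ C) x) +
        contrTwo (structureAt g e x) (fun A => vUp Ψ A x) C)
      + coefB α β x * (∑ A, eta A * (frameDeriv e A (vLow Ψ A) x +
          contrMid (structureAt g e x) (fun A => vUp Ψ A x) A A)) * lower (fun A => vUp Ψ A x) C
      + frameDeriv e C (coefA α) x
      + contr (fun A => vUp Ψ A x) (fun A => frameDeriv e A (coefB α β) x) *
          lower (fun A => vUp Ψ A x) C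
      - 3 * liftDeriv (fun A => vUp Ψ A x) (coefA α x) (coefB α β x) C
          (fun A => frameDeriv e A (coefA α) x) / coefA α x
      - liftDeriv (fun A => vUp Ψ A x) (coefA α x) (coefB α β x) C
          (fun F => frameDeriv e F (coefA α) x + frameDeriv e F (coefB α β) x) /
            (coefA α x + coefB α β x) := fun C => by
    have hs : contr (fun A => vUp Ψ A x)
        (fun F => frameDeriv e F (coefA α) x + frameDeriv e F (coefB α β) x) =
        dotDeriv e Ψ (coefA α) x + dotDeriv e Ψ (coefB α β) x := by
      simp only [contr, mul_add, Finset.sum_add_distrib, dotDeriv]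
    rw [diracShift, acceleration_eq, sum_eta_nablaV, liftDeriv, liftDeriv, hs]
    rfl
  simp only [← hshift, ← vorticity_eq] at hM
  have hω : ∑ D, (vorticity g e Ψ D x : ℂ) • (gamLow D * gam5) =
      vorticitySlash g e Ψ x * gam5 := by
    simp only [vorticitySlash, Matrix.sum_mul, Matrix.smul_mul]
  rw [hω] at hM
  rw [diracOp_eq, structureAt_disf hU he hα hβ hα0 hαβ hΨ hJ hx, diracOp_eq, disfStructureAt, hM]
  have hS : ∑ A, (lower (fun A => vUp Ψ A x) A : ℂ) • gam A = slashV Ψ x := rfl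
  rw [hS]
  have h1 : ∑ A, gam A *ᵥ frameDeriv (disfTetrad α β e Ψ) A Ψ x =
      (coefA α x : ℂ) • ∑ A, gam A *ᵥ frameDeriv e A Ψ x +
      (coefB α β x : ℂ) • (slashV Ψ x *ᵥ ∑ B, (vUp Ψ B x : ℂ) • frameDeriv e B Ψ x) := by
    have hr : ∀ (r : ℝ) (z : Fin 4 → ℂ), r • z = (r : ℂ) • z := fun r z => by
      ext i; simp
    simp only [frameDeriv_disfTetrad, hr, Matrix.mulVec_add, Matrix.mulVec_smul,
      Finset.sum_add_distrib, ← Finset.smul_sum]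
    congr 1
    rw [slashV, Matrix.sum_mulVec, Finset.smul_sum]
    refine Fintype.sum_congr _ _ fun A => ?_
    rw [Matrix.smul_mulVec, smul_smul]
    push_cast
    rfl
  have h2 : ∑ B, (vUp Ψ B x : ℂ) • covDeriv g e B Ψ x =
      ∑ B, (vUp Ψ B x : ℂ) • frameDeriv e B Ψ x -
        (∑ E, (vUp Ψ E x : ℂ) • connMat (structureAt g e x) E) *ᵥ Ψ x := by
    simp only [covDeriv, smul_sub, Finset.sum_sub_distrib, Matrix.sum_mulVec, Matrix.smul_mulVec,
      fockIvanenko_eq]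
  rw [h1, h2]
  simp only [Matrix.add_mulVec, Matrix.sub_mulVec, Matrix.mulVec_sub, Matrix.smul_mulVec,
    Matrix.neg_mulVec, ← Matrix.mulVec_mulVec]
  module

/-- Under the matching conditions the gradients of `a` and `b` and the acceleration leave in `y_C`
only the expansion and the vorticity. -/
theorem diracShift_eq_of_matching {m : ℝ} {s₀ s₁ s₂ : M → ℂ}
    (h : MatchingConditions U g e α β m s₀ s₁ s₂ Ψ) {x : M} (hx : x ∈ U) (hα0 : 0 < α x)
    (hαβ : 0 < α x + β x) (C : Fin 4) :
    (diracShift α β g e Ψ x C : ℂ) =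
      coefB α β x * ((∑ A, eta A * nablaV g e Ψ A A x : ℝ) : ℂ) * vLow Ψ C x
        - 2 * coefB α β x * s₁ x * vorticityLow g e Ψ C x := by
  obtain ⟨h0, -, -, h3⟩ := h x hx
  have h4 := h3 C
  have ha : coefA α x ≠ 0 := (Real.sqrt_pos.2 hα0).ne'
  have hab : coefA α x + coefB α β x ≠ 0 := by
    rw [coefA_add_coefB]; exact (Real.sqrt_pos.2 hαβ).ne'
  have hp : ∀ f : Fin 4 → ℝ, ∑ K, proj Ψ C K x * f K = f C - vLow Ψ C x * ∑ K, vUp Ψ K x * f K :=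
    fun f => by
      simp only [proj, sub_mul, Finset.sum_sub_distrib, ite_mul, one_mul, zero_mul,
        Finset.sum_ite_eq, Finset.mem_univ, if_true, mul_assoc, Finset.mul_sum]
  have hq : ∑ K, vUp Ψ K x * ((3 * coefA α x + 2 * coefB α β x) * frameDeriv e K (coefA α) x
      + coefA α x * frameDeriv e K (coefB α β) x) =
      (3 * coefA α x + 2 * coefB α β x) * dotDeriv e Ψ (coefA α) x +
        coefA α x * dotDeriv e Ψ (coefB α β) x := by
    simp only [dotDeriv, mul_add, Finset.sum_add_distrib, Finset.mul_sum]
    congr 1 <;> exact Finset.sum_congr rfl fun _ _ => by ring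
  rw [hp, hq, h0] at h4
  have habC : (coefA α x : ℂ) + coefB α β x ≠ 0 := by exact_mod_cast hab
  have haC : (coefA α x : ℂ) ≠ 0 := by exact_mod_cast ha
  rw [diracShift, h0]
  push_cast at h4 ⊢
  field_simp
  linear_combination (coefA α x : ℂ) * h4

/-- The matching conditions imply the modified Dirac equation: in `diracOp_disf`, everything
except `a DΨ` cancels. -/
theorem modifiedDirac_of_matching [IsManifold (𝓡 4) ∞ M] (hU : IsOpen U) (he : IsTetrad U g e)
    (hα : ContMDiffOn (𝓡 4) 𝓘(ℝ, ℝ) 2 α U)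
    (hβ : ContMDiffOn (𝓡 4) 𝓘(ℝ, ℝ) 2 β U) (hα0 : ∀ x ∈ U, 0 < α x)
    (hαβ : ∀ x ∈ U, 0 < α x + β x) (hΨ : ContMDiffOn (𝓡 4) 𝓘(ℝ, Fin 4 → ℂ) 2 Ψ U)
    (hJ : ∀ x ∈ U, 0 < currentSq Ψ x) {m : ℝ} {s₀ s₁ s₂ : M → ℂ}
    (h : InomataCondition U g e m s₀ s₁ s₂ (fun x => -4 * s₁ x) (fun x => -4 * s₂ x) Ψ)
    (hm : MatchingConditions U g e α β m s₀ s₁ s₂ Ψ) :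
    ModifiedDiracEquation U g e α β m Ψ := by
  intro x hx
  have hD := diracOp_of_inomata h hx (hJ x hx)
  obtain ⟨-, h0, h2, -⟩ := hm x hx
  have hθ := sum_eta_nablaV_eq hU hΨ hJ hx hD
  have hab : (coefA α x : ℂ) + coefB α β x ≠ 0 := by
    exact_mod_cast coefA_add_coefB (α := α) (β := β) x ▸ (Real.sqrt_pos.2 (hαβ x hx)).ne'
  have hj : (currentNorm Ψ x : ℂ) ≠ 0 := by exact_mod_cast (Real.sqrt_pos.2 (hJ x hx)).ne'
  have hshift : ∑ C, (diracShift α β g e Ψ x C : ℂ) • gam C =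
      (-(coefB α β x : ℂ) * dotDeriv e Ψ (fun y => Real.log (currentNorm Ψ y)) x) • slashV Ψ x
        - (2 * coefB α β x * s₁ x) • vorticitySlash g e Ψ x := by
    simp only [diracShift_eq_of_matching hm hx (hα0 x hx) (hαβ x hx), hθ]
    rw [← sum_vorticityLow_gam, slashV, Finset.smul_sum, Finset.smul_sum,
      ← Finset.sum_sub_distrib]
    refine Fintype.sum_congr _ _ fun C => ?_
    push_cast
    module
  -- `s₀` is prescribed so that the mass term drops out of `∇_V Ψ`
  have h34 : (3 / 4 * s₀ x - Complex.I * m * scalA Ψ x / (4 * currentNorm Ψ x)) =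
      1 / 2 * (dotDeriv e Ψ (fun y => Real.log (currentNorm Ψ y)) x : ℂ) := by
    rw [h0]; field_simp; ring
  rw [diracOp_disf hU he hα hβ hα0 hαβ hΨ hJ hx, hD, sum_vUp_covDeriv_of_inomata h hx (hJ x hx),
    hshift, h34, Matrix.mulVec_add, Matrix.mulVec_mulVec, ← mul_assoc, ← mul_assoc,
    slashV_mul_self (hJ x hx), one_mul, cliff, h2,
    show (fun x => √(α x) * m) x = coefA α x * m from rfl]
  simp only [mul_add, Matrix.mul_smul, mul_one, Matrix.add_mulVec, Matrix.sub_mulVec,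
    Matrix.smul_mulVec, Matrix.mulVec_smul, smul_sub]
  generalize (slashV Ψ x *ᵥ Ψ x) = p
  generalize (vorticitySlash g e Ψ x *ᵥ Ψ x) = q
  generalize ((vorticitySlash g e Ψ x * gam5) *ᵥ Ψ x) = r
  ext i
  simp only [Pi.add_apply, Pi.sub_apply, Pi.smul_apply, smul_eq_mul, Pi.zero_apply]
  push_cast
  field_simp
  linear_combination (-2 * (coefA α x + coefB α β x) * coefA α x * m * Ψ x i : ℂ) * Complex.I_sq

end

end Disformal

end

theorem corollary1 {M : Type*} [TopologicalSpace M] [ChartedSpace (EuclideanSpace ℝ (Fin 4)) M]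
    [IsManifold (𝓡 4) ∞ M] (U : Set M) (hU : IsOpen U)
    (g : Disformal.MetricField M) (e : Disformal.FrameField M) (he : Disformal.IsTetrad U g e)
    (α β : M → ℝ) (hα : ContMDiffOn (𝓡 4) 𝓘(ℝ, ℝ) 2 α U) (hβ : ContMDiffOn (𝓡 4) 𝓘(ℝ, ℝ) 2 β U)
    (hα0 : ∀ x ∈ U, 0 < α x) (hαβ : ∀ x ∈ U, 0 < α x + β x)
    (m : ℝ) (Ψ : Disformal.SpinorField M)
    (hΨ : ContMDiffOn (𝓡 4) 𝓘(ℝ, Fin 4 → ℂ) 2 Ψ U)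
    (hJ : ∀ x ∈ U, 0 < Disformal.currentSq Ψ x)
    (hclass : Disformal.InDisformalClass U g e α β m Ψ) :
    (∀ c : ℝ, (∀ x ∈ U, α x = c) →
      Disformal.DisformallyInvariantSolution U g e α β m (√c * m) Ψ) ∧
    (m = 0 → Disformal.DisformallyInvariantSolution U g e α β 0 0 Ψ) := by
  obtain ⟨s₀, s₁, s₂, hI, hM⟩ := hclass
  have hmod : Disformal.ModifiedDiracEquation U g e α β m Ψ :=
    hM.elim id (Disformal.modifiedDirac_of_matching hU he hα hβ hα0 hαβ hΨ hJ hI)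
  have hdirac : Disformal.SolvesDirac U g e m Ψ := ⟨he, fun x hx => by
    rw [Disformal.diracOp_of_inomata hI hx (hJ x hx), smul_smul, ← sub_smul]
    have : Complex.I * -(Complex.I * m) - (m : ℂ) = 0 := by
      linear_combination (-(m : ℂ)) * Complex.I_sq
    rw [this, zero_smul]⟩
  have htet := Disformal.isTetrad_disfTetrad he hα hβ hα0 hαβ hΨ hJ
  refine ⟨fun c hc => ⟨hdirac, htet, fun x hx => ?_⟩, ?_⟩
  · rw [← hc x hx]
    exact hmod x hx
  · rintro rfl
    exact ⟨hdirac, htet, fun x hx => by simpa using hmod x hx⟩
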